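/- Let $\mathrm{sn}$ be Jacobi's elliptic sine with modulus $k\in\mathbb{C}\setminus\{0,1,-1\}$, i.e. for some $\tau$ with $\operatorname{Im}\tau>0$ and nome $q=e^{i\pi\tau}$, $k=\theta_2(0)^2/\theta_3(0)^2$, $K=\frac{\pi}{2}\theta_3(0)^2$, $\Theta(u)=\theta_4(\pi u/2K)$, $\mathrm{sn}(u)=\frac{\theta_3(0)}{\theta_2(0)}\,\theta_1(\pi u/2K)/\Theta(u)$, and let $\sqrt{k}$ be either square root of $k$. Put $$Q_{a,b}(w,x,y,z)=\mathrm{sn}(a)(wx+yz)-\mathrm{sn}(b)(wy+xz)-\mathrm{sn}(a-b)\big[xy+wz-k\,\mathrm{sn}(a)\,\mathrm{sn}(b)(1+wxyz)\big],$$ and for $\alpha,\beta:\mathbb{Z}\to\mathbb{C}$, with all $\mathrm{sn}(\alpha_n),\mathrm{sn}(\beta_m),\mathrm{sn}(\alpha_n-\beta_m)$ finite, consider the lattice equation Q4 for $v:\mathbb{Z}^2\to\mathbb{C}$, $$Q_{\alpha_{n+1},\beta_{m+1}}(v_{n,m},v_{n+1,m},v_{n,m+1},v_{n+1,m+1})=0\qquad(n,m\in\mathbb{Z}).\tag{1}$$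 Call a solution $v$ *determined* at $(n,m)$ if the equation of (1) on the quad with corners $(n,m),(n+1,m+1)$ has $v_{n+1,m+1}$ as its only solution for that variable, the other three being given, and likewise the equation on the quad with corners $(n-1,m-1),(n,m)$ has $v_{n-1,m-1}$ as its only solution for that variable. Let $$F(\xi,\zeta,\gamma)=\frac{\mathrm{sn}(\zeta)-\mathrm{sn}(\xi+\gamma)}{\mathrm{sn}(\zeta)-\mathrm{sn}(\xi-\gamma)}\,\frac{\Theta(\xi+\gamma)}{\Theta(\xi-\gamma)},$$ and consider the Toda-type relation at $(n,m)$ $$F(\xi_{n,m},\xi_{n+1,m+1},\alpha_{n+1}-\beta_{m+1})\,F(\xi_{n,m},\xi_{n-1,m-1},\alpha_n-\beta_m)=F(\xi_{n,m},\xi_{n-1,m+1},\alpha_n-\beta_{m+1})\,F(\xi_{n,m},\xi_{n+1,m-1},\alpha_{n+1}-\beta_m).\tag{2}$$ Relation (2) is called defined if all the values of $\mathrm{sn}$ in it are finite and no denominator vanishes. For constants $\gamma_0,a,b\in\mathbb{C}$ and $u:\mathbb{Z}\to\mathbb{C}$ consider at $n\in\mathbb{Z}$, with $u=u_n$, $\underline{u}=u_{n-1}$,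 $\tilde u=u_{n+1}$, $\gamma=\gamma_0+2(a-b)n$ and $\omega=k\,\mathrm{sn}(\gamma+a+b)\,\mathrm{sn}(\gamma-a+b)\,\mathrm{sn}(\gamma+a-b)\,\mathrm{sn}(\gamma-a-b)$, the equation $$\begin{aligned} &\Big[k(1-k\omega)\,\mathrm{sn}(2\gamma)\,\mathrm{sn}(2a)\,\mathrm{sn}(2b)-\tfrac{\omega}{\mathrm{sn}(\gamma-a-b)}-\tfrac{\omega}{\mathrm{sn}(\gamma+a+b)}\Big](u-\underline{u}u^3\tilde u)\\ &+\tfrac{\omega}{\mathrm{sn}(\gamma-a+b)}(\underline{u}-\tilde u u^4)+\tfrac{\omega}{\mathrm{sn}(\gamma+a-b)}(\tilde u-\underline{u}u^4)\\ &+\big[\mathrm{sn}(\gamma+a-b)-\mathrm{sn}(\gamma-a+b)-(1-k\omega)(\mathrm{sn}(2a)-\mathrm{sn}(2b))\big](\underline{u}u^2-\tilde u u^2)\\ &-\big[\mathrm{sn}(\gamma+a+b)+\mathrm{sn}(\gamma-a-b)-(1-k\omega)\,\mathrm{sn}(2\gamma)\big](\underline{u}u\tilde u-u^3)=0. \end{aligned}\tag{3}$$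 Its coefficients at $n$ are called defined if all the values of $\mathrm{sn}$ in them are finite and $\mathrm{sn}(\gamma\pm a\pm b)\neq0$ for all four choices of signs. Then: 1. For arbitrary $\alpha,\beta$ as above, if $v_{n,m}=\sqrt{k}\,\mathrm{sn}(\xi_{n,m})$ solves (1), then (2) holds at every $(n,m)$ at which $v$ is determined and (2) is defined. 2. Let the parameters be linear, $\alpha_n=\alpha_0+n(\alpha_1-\alpha_0)$, $\beta_m=\beta_0+m(\beta_1-\beta_0)$, and put $a=\frac12(\alpha_1-\alpha_0)$, $b=\frac12(\beta_1-\beta_0)$, $\gamma_0=\frac12(\alpha_0+\alpha_1-\beta_0-\beta_1)$. Let $v$ satisfy the constraint $v_{n-1,n+1}=v_{n,n}=v_{n+1,n-1}$ for all $n\in\mathbb{Z}$, and let $u_n=v_{n,n}$. (a) For any such $v_{n,m}=\sqrt{k}\,\mathrm{sn}(\xi_{n,m})$, whether or not it solves (1), and with no finiteness condition on the individual $\mathrm{sn}(\alpha_n),\mathrm{sn}(\beta_m)$: at every $n$ at which the coefficients of (3) are defined, (2) at $(n,n)$ is defined, $u_n^2\neq k$ and $ku_n^2\neq1$, relation (2)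 at $(n,n)$ is equivalent to (3) at $n$. (b) If $v$ solves (1) (with $\alpha,\beta$ as above), then $u$ satisfies (3) at every $n$ such that $v$ is determined at $(n,n)$ and the coefficients of (3) at $n$ are defined. 3. For all $\gamma_0,a,b,\xi_0\in\mathbb{C}$, the sequence $u_n=\sqrt{k}\,\mathrm{sn}(\xi_0+\gamma_0n+(a-b)n^2)$ satisfies (3) at every $n$ at which the coefficients of (3) are defined and $u_{n-1},u_n,u_{n+1}$ are finite. -/

import Mathlib

noncomputable section

namespace EllipticQ4

open Complex

/-! ### Jacobi's theta functions and the elliptic sine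

`jacobiTheta₂ z τ = ∑ n, exp (2 π i n z + π i n ^ 2 τ)` is the classical `θ₃(π z)` with nome
`q = exp (π i τ)`.  In terms of it, all with the same normalisation of the argument
(`z` stands for the classical `π z`): -/

/-- The classical `θ₁(π z)`. -/
def theta1 (τ z : ℂ) : ℂ :=
  -I * exp (Real.pi * I * τ / 4 + Real.pi * I * z) * jacobiTheta₂ (z + 1 / 2 + τ / 2) τ

/-- The classical `θ₂(π z)`. -/
def theta2 (τ z : ℂ) : ℂ :=
  exp (Real.pi * I * τ / 4 + Real.pi * I * z) * jacobiTheta₂ (z + τ / 2) τ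

/-- The classical `θ₃(π z)`. -/
def theta3 (τ z : ℂ) : ℂ := jacobiTheta₂ z τ

/-- The classical `θ₄(π z)`. -/
def theta4 (τ z : ℂ) : ℂ := jacobiTheta₂ (z + 1 / 2) τ

/-- The elliptic modulus `k = θ₂(0)² / θ₃(0)²`.  As `τ` runs through the upper half plane, `k`
takes every complex value other than `0`, `1`, `-1`. -/
def modulus (τ : ℂ) : ℂ := theta2 τ 0 ^ 2 / theta3 τ 0 ^ 2

/-- The complete elliptic integral `K = (π / 2) θ₃(0)²`. -/
def quarterPeriod (τ : ℂ) : ℂ := Real.pi / 2 * theta3 τ 0 ^ 2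

/-- Jacobi's theta function `Θ(u) = θ₄(π u / (2 K))`. -/
def Theta (τ u : ℂ) : ℂ := theta4 τ (u / (2 * quarterPeriod τ))

/-- Jacobi's elliptic sine with modulus `k = modulus τ`:
`sn u = (θ₃(0) / θ₂(0)) θ₁(π u / (2 K)) / θ₄(π u / (2 K))`. -/
def sn (τ u : ℂ) : ℂ :=
  theta3 τ 0 / theta2 τ 0 * (theta1 τ (u / (2 * quarterPeriod τ)) / Theta τ u)

/-- `u` is not a pole of the elliptic sine: the poles of `sn` are exactly the zeros of `Θ`. -/
def SnFinite (τ u : ℂ) : Prop := Theta τ u ≠ 0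

/-! ### The lattice equation Q4 -/

/-- The polynomial of Q4 in Jacobi form,
`sn a (w x + y z) - sn b (w y + x z) - sn (a - b) (x y + w z - k sn a sn b (1 + w x y z))`. -/
def Q4 (τ a b w x y z : ℂ) : ℂ :=
  sn τ a * (w * x + y * z) - sn τ b * (w * y + x * z)
    - sn τ (a - b) * (x * y + w * z
        - modulus τ * sn τ a * sn τ b * (1 + w * x * y * z))

/-- The elliptic sines in the coefficients of the lattice system are finite. -/
def ParametersFinite (τ : ℂ) (α β : ℤ → ℂ) : Prop :=
  (∀ n, SnFinite τ (α n)) ∧ (∀ m, SnFinite τ (β m)) ∧ ∀ n m, SnFinite τ (α n - β m)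

/-- `v` solves Q4 on `ℤ²`.  The parameter `α n` belongs to the edges that join the columns `n - 1`
and `n`, and `β m` to the edges that join the rows `m - 1` and `m`. -/
def IsQ4Solution (τ : ℂ) (α β : ℤ → ℂ) (v : ℤ → ℤ → ℂ) : Prop :=
  ∀ n m : ℤ, Q4 τ (α (n + 1)) (β (m + 1))
    (v n m) (v (n + 1) m) (v n (m + 1)) (v (n + 1) (m + 1)) = 0

/-- At the vertex `(n, m)` the quad equation on the upper right quad has exactly one solution for
the variable at `(n + 1, m + 1)`, the three other variables being given, and the quad equation on
the lower left quad has exactly one solution for the variable at `(n - 1, m - 1)`. -/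
def DiagonallyDetermined (τ : ℂ) (α β : ℤ → ℂ) (v : ℤ → ℤ → ℂ) (n m : ℤ) : Prop :=
  (∃! z : ℂ, Q4 τ (α (n + 1)) (β (m + 1)) (v n m) (v (n + 1) m) (v n (m + 1)) z = 0) ∧
  (∃! w : ℂ, Q4 τ (α n) (β m) w (v n (m - 1)) (v (n - 1) m) (v n m) = 0)

/-- The constraint `v_{n-1,n+1} = v_{n,n} = v_{n+1,n-1}` for all `n`. -/
def DiagonalConstraint (v : ℤ → ℤ → ℂ) : Prop :=
  ∀ n : ℤ, v (n - 1) (n + 1) = v n n ∧ v n n = v (n + 1) (n - 1)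

/-! ### The Toda-type five-point relation -/

/-- `v = √k sn ξ` on the lattice, where `s` is the chosen square root of `k`. -/
def IsUniformisation (τ s : ℂ) (v ξ : ℤ → ℤ → ℂ) : Prop :=
  ∀ n m : ℤ, SnFinite τ (ξ n m) ∧ v n m = s * sn τ (ξ n m)

/-- The leg function
`F(ξ, ζ, γ) = (sn ζ - sn (ξ + γ)) / (sn ζ - sn (ξ - γ)) * Θ(ξ + γ) / Θ(ξ - γ)`. -/
def legF (τ ξ ζ γ : ℂ) : ℂ :=
  (sn τ ζ - sn τ (ξ + γ)) / (sn τ ζ - sn τ (ξ - γ)) * (Theta τ (ξ + γ) / Theta τ (ξ - γ))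

/-- The expression `F(ξ, ζ, γ)` is defined: its elliptic sines are finite and its denominators
do not vanish. -/
def LegDefined (τ ξ ζ γ : ℂ) : Prop :=
  SnFinite τ ζ ∧ SnFinite τ (ξ + γ) ∧ SnFinite τ (ξ - γ) ∧ sn τ ζ ≠ sn τ (ξ - γ)

/-- The Toda-type relation at `(n, m)` between the five variables at `(n, m)` and at its four
diagonal neighbours. -/
def TodaRelation (τ : ℂ) (α β : ℤ → ℂ) (ξ : ℤ → ℤ → ℂ) (n m : ℤ) : Prop :=
  legF τ (ξ n m) (ξ (n + 1) (m + 1)) (α (n + 1) - β (m + 1))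
      * legF τ (ξ n m) (ξ (n - 1) (m - 1)) (α n - β m)
    = legF τ (ξ n m) (ξ (n - 1) (m + 1)) (α n - β (m + 1))
      * legF τ (ξ n m) (ξ (n + 1) (m - 1)) (α (n + 1) - β m)

/-- The four factors of the Toda-type relation at `(n, m)` are defined. -/
def TodaRelationDefined (τ : ℂ) (α β : ℤ → ℂ) (ξ : ℤ → ℤ → ℂ) (n m : ℤ) : Prop :=
  LegDefined τ (ξ n m) (ξ (n + 1) (m + 1)) (α (n + 1) - β (m + 1)) ∧
  LegDefined τ (ξ n m) (ξ (n - 1) (m - 1)) (α n - β m) ∧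
  LegDefined τ (ξ n m) (ξ (n - 1) (m + 1)) (α n - β (m + 1)) ∧
  LegDefined τ (ξ n m) (ξ (n + 1) (m - 1)) (α (n + 1) - β m)

/-! ### The second-order elliptic difference equation -/

/-- `ω = k sn(γ+a+b) sn(γ-a+b) sn(γ+a-b) sn(γ-a-b)`. -/
def omega (τ γ a b : ℂ) : ℂ :=
  modulus τ * sn τ (γ + a + b) * sn τ (γ - a + b) * sn τ (γ + a - b) * sn τ (γ - a - b)

/-- The relation between three consecutive values `um`, `u`, `up` (previous, current, next). -/
def EllipticRelation (τ γ a b um u up : ℂ) : Prop :=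
  (modulus τ * (1 - modulus τ * omega τ γ a b) * sn τ (2 * γ) * sn τ (2 * a) * sn τ (2 * b)
      - omega τ γ a b / sn τ (γ - a - b) - omega τ γ a b / sn τ (γ + a + b))
        * (u - um * u ^ 3 * up)
    + omega τ γ a b / sn τ (γ - a + b) * (um - up * u ^ 4)
    + omega τ γ a b / sn τ (γ + a - b) * (up - um * u ^ 4)
    + (sn τ (γ + a - b) - sn τ (γ - a + b)
        - (1 - modulus τ * omega τ γ a b) * (sn τ (2 * a) - sn τ (2 * b)))
        * (um * u ^ 2 - up * u ^ 2)
    - (sn τ (γ + a + b) + sn τ (γ - a - b)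
        - (1 - modulus τ * omega τ γ a b) * sn τ (2 * γ))
        * (um * u * up - u ^ 3) = 0

/-- The coefficients of the relation are defined: the elliptic sines in it are finite, and those
that stand in denominators do not vanish. -/
def CoefficientsDefined (τ γ a b : ℂ) : Prop :=
  SnFinite τ (2 * γ) ∧ SnFinite τ (2 * a) ∧ SnFinite τ (2 * b) ∧
  (SnFinite τ (γ + a + b) ∧ sn τ (γ + a + b) ≠ 0) ∧
  (SnFinite τ (γ - a + b) ∧ sn τ (γ - a + b) ≠ 0) ∧
  (SnFinite τ (γ + a - b) ∧ sn τ (γ + a - b) ≠ 0) ∧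
  (SnFinite τ (γ - a - b) ∧ sn τ (γ - a - b) ≠ 0)

/-- The non-autonomous parameter `γ = γ₀ + 2 (a - b) n`. -/
def gam (γ₀ a b : ℂ) (n : ℤ) : ℂ := γ₀ + 2 * (a - b) * n

/-- The second-order non-autonomous elliptic difference equation for `u`, at the place `n`. -/
def EllipticEquation (τ γ₀ a b : ℂ) (u : ℤ → ℂ) (n : ℤ) : Prop :=
  EllipticRelation τ (gam γ₀ a b n) a b (u (n - 1)) (u n) (u (n + 1))

end EllipticQ4

end

open EllipticQ4

/-! Write `√k sn = θ₁/θ₄` (`thetaRatio`) and measure arguments in units of `2K`. Everything then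
follows from one identity, Weierstrass' three-term relation for `θ₁`, which is the Plücker relation
among 2×2 determinants formed from two theta functions of doubled period. Half-period shifts and
confluence turn it into quartic and cubic identities for products of `θ₁` and `θ₄` whose shifts add
up to zero.

Call `θ₄(p) x - θ₁(p)` a leg. Multiplying out three legs and applying the cubic identities gives the
three-leg form of Q4 (`three_leg`): a difference of two products of legs based at `ξ` equals
`θ₁(2ξ)/θ₁(ξ)` times the Q4 polynomial, up to a constant. Around a vertex the short legs of the four
nearest neighbours cancel, and only the long legs of the diagonal neighbours are left: this is the
Toda-type relation (`toda_of_quad`). Determinedness replaces division by short legs, which may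
vanish.

With linear parameters and the constraint, two of the four diagonal values equal the central one.
Multiplying out the four long legs and applying the quartic identities shows that the difference of
the two sides of the Toda-type relation is an explicit multiple of the elliptic equation
(`toda_eq_ellRel`). The trivial solution makes one leg vanish on each side.

The factor `thetaDup`, that is `θ₁(2ξ)/θ₁(ξ)`, vanishes at branch points of `sn`, where these
identities lose information. There the elliptic equation is obtained as a limit in `ξ`
(`ellRel_of_quad`, `ellRel_thetaRatio`), while the Toda-type relation degenerates to an identity
(`toda_of_thetaDup_eq_zero`). For lattice solutions given without a uniformisation, surjectivity of
`sn` (`exists_thetaRatio_eq`) supplies a `ξ` for the central value. -/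

noncomputable section

namespace EllipticQ4

open Complex Filter Topology

/-! ### Products of two theta series -/

section TwoVariable

variable {τ : ℂ}

/-- `θ₃(2x)` for the doubled period. -/
def thetaEven (τ x : ℂ) : ℂ := jacobiTheta₂ (2 * x) (2 * τ)

/-- `θ₂(2x)` for the doubled period. -/
def thetaOdd (τ x : ℂ) : ℂ :=
  exp (2 * Real.pi * I * x + Real.pi * I * τ / 2) * jacobiTheta₂ (2 * x + τ) (2 * τ)

lemma two_mul_im_pos (hτ : 0 < τ.im) : 0 < (2 * τ).im := by simpa using hτ

lemma hasSum_jacobiTheta₂_mul {τ : ℂ} (hτ : 0 < τ.im) (x y : ℂ) :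
    HasSum (fun p : ℤ × ℤ => jacobiTheta₂_term p.1 x τ * jacobiTheta₂_term p.2 y τ)
      (jacobiTheta₂ x τ * jacobiTheta₂ y τ) := by
  have hx := ((summable_jacobiTheta₂_term_iff x τ).2 hτ).norm
  have hy := ((summable_jacobiTheta₂_term_iff y τ).2 hτ).norm
  rw [jacobiTheta₂, jacobiTheta₂, tsum_mul_tsum_of_summable_norm hx hy]
  exact (summable_mul_of_summable_norm hx hy).hasSum

/-- The two ranges are the pairs of integers of even and of odd sum. The split separates the
variables in a product of two theta series. -/
lemma isCompl_range_sum_diff :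
    IsCompl (Set.range fun p : ℤ × ℤ => (p.1 + p.2, p.1 - p.2))
      (Set.range fun p : ℤ × ℤ => (p.1 + p.2 + 1, p.1 - p.2)) := by
  constructor
  · rw [Set.disjoint_left]
    rintro _ ⟨p, rfl⟩ ⟨q, hq⟩
    simp only [Prod.mk.injEq] at hq
    omega
  · rw [codisjoint_iff_le_sup]
    rintro ⟨m, n⟩ -
    rcases Int.even_or_odd' (m + n) with ⟨k, hk | hk⟩
    · exact Or.inl ⟨(k, m - k), by ext <;> (simp; try omega)⟩
    · exact Or.inr ⟨(k, m - k - 1), by ext <;> simp <;> omega⟩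

/-- For `m = i + j`, `n = i - j` one has `m² + n² = 2i² + 2j²` and `m(x+y) + n(x-y) = 2ix + 2jy`, so
the double series factors with period `2τ`. Pairs of odd sum give the same with `i`, `j` replaced by
`i + 1/2`, `j + 1/2`. -/
lemma jacobiTheta₂_add_mul_sub (hτ : 0 < τ.im) (x y : ℂ) :
    jacobiTheta₂ (x + y) τ * jacobiTheta₂ (x - y) τ
      = thetaEven τ x * thetaEven τ y + thetaOdd τ x * thetaOdd τ y := by
  have hτ' := two_mul_im_pos hτ
  refine (hasSum_jacobiTheta₂_mul hτ (x + y) (x - y)).unique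
    (HasSum.add_isCompl isCompl_range_sum_diff ?_ ?_)
  · refine (Function.Injective.hasSum_range_iff
      (f := fun p : ℤ × ℤ => jacobiTheta₂_term p.1 (x + y) τ * jacobiTheta₂_term p.2 (x - y) τ)
      (fun p q h => ?_)).2 ?_
    · simp only [Prod.mk.injEq] at h
      ext <;> omega
    · refine (hasSum_jacobiTheta₂_mul hτ' (2 * x) (2 * y)).congr_fun ?_
      rintro ⟨m, n⟩
      simp only [Function.comp, jacobiTheta₂_term, ← exp_add]
      congr 1
      push_cast
      ring
  · refine (Function.Injective.hasSum_range_iff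
      (f := fun p : ℤ × ℤ => jacobiTheta₂_term p.1 (x + y) τ * jacobiTheta₂_term p.2 (x - y) τ)
      (fun p q h => ?_)).2 ?_
    · simp only [Prod.mk.injEq] at h
      ext <;> omega
    · have h := (hasSum_jacobiTheta₂_mul hτ' (2 * x + τ) (2 * y + τ)).mul_left
        (exp (2 * Real.pi * I * x + Real.pi * I * τ / 2)
          * exp (2 * Real.pi * I * y + Real.pi * I * τ / 2))
      have e : thetaOdd τ x * thetaOdd τ y
          = exp (2 * Real.pi * I * x + Real.pi * I * τ / 2)
          * exp (2 * Real.pi * I * y + Real.pi * I * τ / 2) *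
          (jacobiTheta₂ (2 * x + τ) (2 * τ) * jacobiTheta₂ (2 * y + τ) (2 * τ)) := by
        unfold thetaOdd; ring
      rw [e]
      refine h.congr_fun ?_
      rintro ⟨m, n⟩
      simp only [Function.comp, jacobiTheta₂_term, ← exp_add]
      congr 1
      push_cast
      ring

/-- Shifting `x` by `1/2 + τ/2` exchanges the even and the odd function, up to a common exponential
and one sign. The sign turns the sum of products into a determinant. -/
lemma theta1_add_mul_sub (hτ : 0 < τ.im) (x y : ℂ) :
    theta1 τ (x + y) * theta1 τ (x - y)
      = thetaEven τ x * thetaOdd τ y - thetaOdd τ x * thetaEven τ y := by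
  have h := jacobiTheta₂_add_mul_sub hτ (x + 1 / 2 + τ / 2) y
  have hE : exp (Real.pi * I * τ / 2 + 2 * Real.pi * I * x) * thetaEven τ (x + 1 / 2 + τ / 2)
      = thetaOdd τ x := by
    rw [thetaEven, thetaOdd, show 2 * (x + 1 / 2 + τ / 2) = 2 * x + τ + 1 by ring,
      jacobiTheta₂_add_left, add_comm (Real.pi * I * τ / 2)]
  have hO : exp (Real.pi * I * τ / 2 + 2 * Real.pi * I * x) * thetaOdd τ (x + 1 / 2 + τ / 2)
      = -thetaEven τ x := by
    rw [thetaEven, thetaOdd, show 2 * (x + 1 / 2 + τ / 2) + τ = 2 * x + 2 * τ + 1 by ring,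
      jacobiTheta₂_add_left, jacobiTheta₂_add_left', ← mul_assoc, ← mul_assoc, ← exp_add,
      ← exp_add]
    rw [show Real.pi * I * τ / 2 + 2 * Real.pi * I * x
      + (2 * Real.pi * I * (x + 1 / 2 + τ / 2) + Real.pi * I * τ / 2)
      + -Real.pi * I * (2 * τ + 2 * (2 * x)) = Real.pi * I by ring, exp_pi_mul_I]
    ring
  have hp : exp (Real.pi * I * τ / 4 + Real.pi * I * (x + y))
      * exp (Real.pi * I * τ / 4 + Real.pi * I * (x - y))
      = exp (Real.pi * I * τ / 2 + 2 * Real.pi * I * x) := by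
    rw [← exp_add]; congr 1; ring
  have e1 : x + y + 1 / 2 + τ / 2 = x + 1 / 2 + τ / 2 + y := by ring
  have e2 : x - y + 1 / 2 + τ / 2 = x + 1 / 2 + τ / 2 - y := by ring
  rw [theta1, theta1, e1, e2]
  calc _ = I ^ 2 * (exp (Real.pi * I * τ / 4 + Real.pi * I * (x + y))
      * exp (Real.pi * I * τ / 4 + Real.pi * I * (x - y)))
      * (jacobiTheta₂ (x + 1 / 2 + τ / 2 + y) τ * jacobiTheta₂ (x + 1 / 2 + τ / 2 - y) τ) := by
        ring
    _ = _ := by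
        rw [hp, h, I_sq]
        linear_combination (-thetaEven τ y) * hE - thetaOdd τ y * hO

/-- The three-term relation of Weierstrass. -/
lemma theta1_weierstrass (hτ : 0 < τ.im) (x y u v : ℂ) :
    theta1 τ (x + y) * theta1 τ (x - y) * (theta1 τ (u + v) * theta1 τ (u - v))
      - theta1 τ (x + u) * theta1 τ (x - u) * (theta1 τ (y + v) * theta1 τ (y - v))
      + theta1 τ (x + v) * theta1 τ (x - v) * (theta1 τ (y + u) * theta1 τ (y - u)) = 0 := by
  -- Each pair of factors is now a 2×2 determinant of the vectors (`thetaEven`, `thetaOdd`) at two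
  -- of the four points, and the claim is the Plücker relation.
  simp only [theta1_add_mul_sub hτ]
  ring

/-- Identical vanishing would pass from `τ` to `2τ`, hence to periods of arbitrarily large imaginary
part, where the value at `0` is close to `1`. -/
lemma exists_jacobiTheta₂_ne_zero (hτ : 0 < τ.im) : ∃ z, jacobiTheta₂ z τ ≠ 0 := by
  by_contra! h
  have step : ∀ σ : ℂ, 0 < σ.im → (∀ z, jacobiTheta₂ z σ = 0) →
      ∀ z, jacobiTheta₂ z (2 * σ) = 0 := by
    intro σ hσ h0 z
    have h1 := jacobiTheta₂_add_mul_sub hσ (z / 2) (z / 2)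
    have h2 := jacobiTheta₂_add_mul_sub hσ (z / 2 + 1 / 2) (z / 2)
    have hE : thetaEven σ (z / 2 + 1 / 2) = thetaEven σ (z / 2) := by
      rw [thetaEven, thetaEven, show 2 * (z / 2 + 1 / 2) = 2 * (z / 2) + 1 by ring,
        jacobiTheta₂_add_left]
    have hO : thetaOdd σ (z / 2 + 1 / 2) = -thetaOdd σ (z / 2) := by
      rw [thetaOdd, thetaOdd, show 2 * (z / 2 + 1 / 2) + σ = 2 * (z / 2) + σ + 1 by ring,
        jacobiTheta₂_add_left, show 2 * Real.pi * I * (z / 2 + 1 / 2) + Real.pi * I * σ / 2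
          = 2 * Real.pi * I * (z / 2) + Real.pi * I * σ / 2 + Real.pi * I by ring, exp_add,
        exp_pi_mul_I]
      ring
    -- The two instances now read `E² + O² = 0` and `E² - O² = 0`.
    rw [hE, hO] at h2
    simp only [h0] at h1 h2
    have h3 : thetaEven σ (z / 2) ^ 2 = 0 := by linear_combination -(h1 + h2) / 2
    have h4 := pow_eq_zero_iff (two_ne_zero) |>.1 h3
    rwa [thetaEven, mul_div_cancel₀ _ (two_ne_zero' ℂ)] at h4
  have im_pow : ∀ n : ℕ, ((2 : ℂ) ^ n * τ).im = 2 ^ n * τ.im := fun n => by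
    rw [show ((2 : ℂ) ^ n) = ((2 ^ n : ℝ) : ℂ) by push_cast; ring, im_ofReal_mul]
  have all : ∀ n : ℕ, ∀ z, jacobiTheta₂ z (2 ^ n * τ) = 0 := by
    intro n
    induction n with
    | zero => simpa using h
    | succ n ih =>
      rw [pow_succ', mul_assoc]
      exact step _ (by rw [im_pow]; positivity) ih
  obtain ⟨n, hn⟩ := pow_unbounded_of_one_lt (1 / τ.im) (one_lt_two (α := ℝ))
  have him : 1 ≤ ((2 : ℂ) ^ n * τ).im := by
    rw [im_pow]
    rw [div_lt_iff₀ hτ] at hn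
    exact hn.le
  have hb := norm_jacobiTheta_sub_one_le (zero_lt_one.trans_le him)
  rw [jacobiTheta_eq_jacobiTheta₂, all n 0] at hb
  set t := Real.exp (-Real.pi * ((2 : ℂ) ^ n * τ).im)
  -- The bound on the distance from `1` is `2t / (1 - t)`, which is below `1` exactly for `t < 1/3`.
  have ht : t < 1 / 3 := by
    have h3 : (3 : ℝ) < Real.exp (Real.pi * ((2 : ℂ) ^ n * τ).im) := by
      have := Real.add_one_le_exp (Real.pi * ((2 : ℂ) ^ n * τ).im)
      nlinarith [Real.pi_gt_three]
    have : t = (Real.exp (Real.pi * ((2 : ℂ) ^ n * τ).im))⁻¹ := by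
      rw [← Real.exp_neg]; simp [t]
    rw [this, one_div]
    exact inv_strictAnti₀ (by norm_num) h3
  have ht0 : 0 < t := Real.exp_pos _
  rw [zero_sub, norm_neg, norm_one, div_mul_eq_mul_div, le_div_iff₀ (by linarith)] at hb
  linarith

end TwoVariable

section Theta

variable {τ : ℂ}

/-! ### Parity, shifts by half periods, regularity -/

lemma theta4_neg (z : ℂ) : theta4 τ (-z) = theta4 τ z := by
  rw [theta4, theta4, ← jacobiTheta₂_neg_left, show -(-z + 1 / 2) = z - 1 / 2 by ring,
    ← jacobiTheta₂_add_left]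
  congr 1; ring

lemma theta3_neg (z : ℂ) : theta3 τ (-z) = theta3 τ z := jacobiTheta₂_neg_left z τ

lemma theta1_add_tau_half (z : ℂ) : theta1 τ (z + τ / 2)
    = I * exp (-(Real.pi * I * τ / 4) - Real.pi * I * z) * theta4 τ z := by
  rw [theta1, theta4, show z + τ / 2 + 1 / 2 + τ / 2 = z + 1 / 2 + τ by ring,
    jacobiTheta₂_add_left', ← mul_assoc, mul_assoc (-I), ← exp_add,
    show Real.pi * I * τ / 4 + Real.pi * I * (z + τ / 2) + -Real.pi * I * (τ + 2 * (z + 1 / 2))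
      = -(Real.pi * I * τ / 4) - Real.pi * I * z - Real.pi * I by ring,
    exp_sub _ (Real.pi * I), exp_pi_mul_I]
  ring

lemma theta4_add_tau_half (z : ℂ) : theta4 τ (z + τ / 2)
    = I * exp (-(Real.pi * I * τ / 4) - Real.pi * I * z) * theta1 τ z := by
  rw [theta1, theta4, show z + τ / 2 + 1 / 2 = z + 1 / 2 + τ / 2 by ring]
  have h : exp (-(Real.pi * I * τ / 4) - Real.pi * I * z)
      * exp (Real.pi * I * τ / 4 + Real.pi * I * z) = 1 := by
    rw [← exp_add, ← exp_zero]; congr 1; ring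
  linear_combination (-jacobiTheta₂ (z + 1 / 2 + τ / 2) τ) * h
    + (exp (-(Real.pi * I * τ / 4) - Real.pi * I * z)
      * exp (Real.pi * I * τ / 4 + Real.pi * I * z) * jacobiTheta₂ (z + 1 / 2 + τ / 2) τ) * I_sq

lemma theta1_add_half (z : ℂ) : theta1 τ (z + 1 / 2) = theta2 τ z := by
  rw [theta1, theta2, show z + 1 / 2 + 1 / 2 + τ / 2 = z + τ / 2 + 1 by ring,
    jacobiTheta₂_add_left, show Real.pi * I * τ / 4 + Real.pi * I * (z + 1 / 2)
      = Real.pi * I * τ / 4 + Real.pi * I * z + Real.pi / 2 * I by ring, exp_add _ (Real.pi / 2 * I),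
    exp_pi_div_two_mul_I]
  linear_combination (-exp (Real.pi * I * τ / 4 + Real.pi * I * z)
    * jacobiTheta₂ (z + τ / 2) τ) * I_sq

lemma theta2_add_half (z : ℂ) : theta2 τ (z + 1 / 2) = -theta1 τ z := by
  rw [theta1, theta2, show z + 1 / 2 + τ / 2 = z + 1 / 2 + τ / 2 by ring,
    show Real.pi * I * τ / 4 + Real.pi * I * (z + 1 / 2)
      = Real.pi * I * τ / 4 + Real.pi * I * z + Real.pi / 2 * I by ring, exp_add _ (Real.pi / 2 * I),
    exp_pi_div_two_mul_I]
  ring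

lemma theta4_add_half (z : ℂ) : theta4 τ (z + 1 / 2) = theta3 τ z := by
  rw [theta4, theta3, show z + 1 / 2 + 1 / 2 = z + 1 by ring, jacobiTheta₂_add_left]

lemma theta2_add_tau_half (z : ℂ) : theta2 τ (z + τ / 2)
    = exp (-(Real.pi * I * τ / 4) - Real.pi * I * z) * theta3 τ z := by
  rw [theta2, theta3, show z + τ / 2 + τ / 2 = z + τ by ring,
    jacobiTheta₂_add_left', ← mul_assoc, ← exp_add]
  congr 2; ring

lemma theta3_add_tau_half (z : ℂ) : theta3 τ (z + τ / 2)
    = exp (-(Real.pi * I * τ / 4) - Real.pi * I * z) * theta2 τ z := by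
  rw [theta2, theta3, ← mul_assoc, ← exp_add]
  simp

lemma theta1_neg (z : ℂ) : theta1 τ (-z) = -theta1 τ z := by
  have h := theta4_add_tau_half (τ := τ) z
  have hs := theta1_add_tau_half (τ := τ) (-z - τ / 2)
  rw [show -z - τ / 2 + τ / 2 = -z by ring, show -z - τ / 2 = -(z + τ / 2) by ring, theta4_neg,
    h] at hs
  have he : exp (-(Real.pi * I * τ / 4) - Real.pi * I * -(z + τ / 2))
      * exp (-(Real.pi * I * τ / 4) - Real.pi * I * z) = 1 := by
    rw [← exp_add, ← exp_zero]; congr 1; ring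
  rw [hs]
  linear_combination (-theta1 τ z) * he + (exp (-(Real.pi * I * τ / 4)
    - Real.pi * I * -(z + τ / 2)) * exp (-(Real.pi * I * τ / 4) - Real.pi * I * z)
    * theta1 τ z) * I_sq

lemma theta2_neg (z : ℂ) : theta2 τ (-z) = theta2 τ z := by
  rw [← theta1_add_half, show -z + 1 / 2 = -(z - 1 / 2) by ring, theta1_neg, ← theta2_add_half,
    sub_add_cancel]

lemma theta1_sub_tau_half (z : ℂ) : theta1 τ (z - τ / 2)
    = -I * exp (-(Real.pi * I * τ / 4) + Real.pi * I * z) * theta4 τ z := by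
  rw [show z - τ / 2 = -(-z + τ / 2) by ring, theta1_neg, theta1_add_tau_half, theta4_neg]
  rw [show -(Real.pi * I * τ / 4) - Real.pi * I * -z = -(Real.pi * I * τ / 4) + Real.pi * I * z by
    ring]
  ring

lemma theta1_add_one (z : ℂ) : theta1 τ (z + 1) = -theta1 τ z := by
  rw [← theta2_add_half, ← theta1_add_half]; congr 1; ring

lemma theta4_add_one (z : ℂ) : theta4 τ (z + 1) = theta4 τ z := by
  rw [theta4, theta4, add_right_comm, jacobiTheta₂_add_left]

lemma exp_quasiperiod (z : ℂ) : exp (-(Real.pi * I * τ / 4) - Real.pi * I * (z + τ / 2))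
    * exp (-(Real.pi * I * τ / 4) - Real.pi * I * z) = exp (-(Real.pi * I * τ) - 2 * Real.pi * I * z) := by
  rw [← exp_add]; congr 1; ring

lemma theta1_add_tau (z : ℂ) :
    theta1 τ (z + τ) = -exp (-(Real.pi * I * τ) - 2 * Real.pi * I * z) * theta1 τ z := by
  rw [show z + τ = z + τ / 2 + τ / 2 by ring, theta1_add_tau_half, theta4_add_tau_half,
    ← exp_quasiperiod]
  linear_combination (exp (-(Real.pi * I * τ / 4) - Real.pi * I * (z + τ / 2))
    * exp (-(Real.pi * I * τ / 4) - Real.pi * I * z) * theta1 τ z) * I_sq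

lemma theta4_add_tau (z : ℂ) :
    theta4 τ (z + τ) = -exp (-(Real.pi * I * τ) - 2 * Real.pi * I * z) * theta4 τ z := by
  rw [show z + τ = z + τ / 2 + τ / 2 by ring, theta4_add_tau_half, theta1_add_tau_half,
    ← exp_quasiperiod]
  linear_combination (exp (-(Real.pi * I * τ / 4) - Real.pi * I * (z + τ / 2))
    * exp (-(Real.pi * I * τ / 4) - Real.pi * I * z) * theta4 τ z) * I_sq

lemma differentiable_jacobiTheta₂_comp (hτ : 0 < τ.im) {f : ℂ → ℂ} (hf : Differentiable ℂ f) :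
    Differentiable ℂ fun z => jacobiTheta₂ (f z) τ := fun z =>
  (differentiableAt_jacobiTheta₂_fst (f z) hτ).comp z (hf z)

lemma differentiable_theta1 (hτ : 0 < τ.im) : Differentiable ℂ (theta1 τ) := by
  have := differentiable_jacobiTheta₂_comp hτ (f := fun z => z + 1 / 2 + τ / 2) (by fun_prop)
  unfold theta1; fun_prop

lemma differentiable_theta2 (hτ : 0 < τ.im) : Differentiable ℂ (theta2 τ) := by
  have := differentiable_jacobiTheta₂_comp hτ (f := fun z => z + τ / 2) (by fun_prop)
  unfold theta2; fun_prop

lemma differentiable_theta3 (hτ : 0 < τ.im) : Differentiable ℂ (theta3 τ) :=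
  differentiable_jacobiTheta₂_comp hτ differentiable_fun_id

lemma differentiable_theta4 (hτ : 0 < τ.im) : Differentiable ℂ (theta4 τ) :=
  differentiable_jacobiTheta₂_comp hτ (by fun_prop)

lemma eventually_ne_zero_of_differentiable {f : ℂ → ℂ} (hf : Differentiable ℂ f)
    (h : ∃ z, f z ≠ 0) (z₀ : ℂ) : ∀ᶠ z in 𝓝[≠] z₀, f z ≠ 0 := by
  by_contra hc
  obtain ⟨z, hz⟩ := h
  have hf' : AnalyticOnNhd ℂ f Set.univ := fun z _ => hf.analyticAt z
  exact hz (hf'.eqOn_zero_of_preconnected_of_frequently_eq_zero isPreconnected_univ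
    (Set.mem_univ z₀) hc (Set.mem_univ z))

lemma eq_of_eventuallyEq_nhdsNE {f g : ℂ → ℂ} {z : ℂ} (hf : ContinuousAt f z)
    (hg : ContinuousAt g z) (h : ∀ᶠ w in 𝓝[≠] z, f w = g w) : f z = g z :=
  ((hf.eventuallyEq_nhds_iff_eventuallyEq_nhdsNE hg).1 h).eq_of_nhds

lemma eventually_theta1_ne_zero (hτ : 0 < τ.im) (z₀ : ℂ) :
    ∀ᶠ z in 𝓝[≠] z₀, theta1 τ z ≠ 0 := by
  refine eventually_ne_zero_of_differentiable (differentiable_theta1 hτ) ?_ z₀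
  obtain ⟨z, hz⟩ := exists_jacobiTheta₂_ne_zero hτ
  refine ⟨z - 1 / 2 - τ / 2, ?_⟩
  rw [theta1, show z - 1 / 2 - τ / 2 + 1 / 2 + τ / 2 = z by ring]
  simp [hz, exp_ne_zero]

lemma eventually_theta2_ne_zero (hτ : 0 < τ.im) (z₀ : ℂ) :
    ∀ᶠ z in 𝓝[≠] z₀, theta2 τ z ≠ 0 := by
  refine eventually_ne_zero_of_differentiable (differentiable_theta2 hτ) ?_ z₀
  obtain ⟨z, hz⟩ := exists_jacobiTheta₂_ne_zero hτ
  refine ⟨z - τ / 2, ?_⟩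
  rw [theta2, show z - τ / 2 + τ / 2 = z by ring]
  simp [hz, exp_ne_zero]

lemma eventually_theta3_ne_zero (hτ : 0 < τ.im) (z₀ : ℂ) :
    ∀ᶠ z in 𝓝[≠] z₀, theta3 τ z ≠ 0 :=
  eventually_ne_zero_of_differentiable (differentiable_theta3 hτ)
    (exists_jacobiTheta₂_ne_zero hτ) z₀

lemma eventually_theta4_ne_zero (hτ : 0 < τ.im) (z₀ : ℂ) :
    ∀ᶠ z in 𝓝[≠] z₀, theta4 τ z ≠ 0 := by
  refine eventually_ne_zero_of_differentiable (differentiable_theta4 hτ) ?_ z₀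
  obtain ⟨z, hz⟩ := exists_jacobiTheta₂_ne_zero hτ
  exact ⟨z - 1 / 2, by rwa [theta4, sub_add_cancel]⟩

/-! ### Quartic identities -/

lemma theta1111_sub (hτ : 0 < τ.im) {e₁ e₂ e₃ e₄ : ℂ} (he : e₁ + e₂ + e₃ + e₄ = 0) (x : ℂ) :
    theta1 τ (x + e₁) * theta1 τ (x + e₂) * theta1 τ (x + e₃) * theta1 τ (x + e₄)
      - theta1 τ (x - e₁) * theta1 τ (x - e₂) * theta1 τ (x - e₃) * theta1 τ (x - e₄)
      = theta1 τ (2 * x) * theta1 τ (e₁ + e₂) * theta1 τ (e₁ + e₃) * theta1 τ (e₁ + e₄) := by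
  obtain rfl : e₄ = -(e₁ + e₂ + e₃) := by linear_combination he
  -- Chosen so that the sums and differences of the four arguments are, up to sign, `x ± eᵢ`, `2x`
  -- and `e₁ + eⱼ`.
  have h := theta1_weierstrass hτ (x + (e₁ + e₂) / 2) ((e₁ - e₂) / 2) (x - (e₁ + e₂) / 2)
    ((e₁ + e₂) / 2 + e₃)
  have hn := theta1_neg (τ := τ) (x - e₁)
  ring_nf at h hn ⊢
  rw [hn] at h
  linear_combination h

/-- Shift `x` by `τ/2` in `theta1111_sub`. Because the `eᵢ` add up to zero, all three terms acquire
the same exponential factor. -/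
lemma theta4444_sub (hτ : 0 < τ.im) {e₁ e₂ e₃ e₄ : ℂ} (he : e₁ + e₂ + e₃ + e₄ = 0) (x : ℂ) :
    theta4 τ (x + e₁) * theta4 τ (x + e₂) * theta4 τ (x + e₃) * theta4 τ (x + e₄)
      - theta4 τ (x - e₁) * theta4 τ (x - e₂) * theta4 τ (x - e₃) * theta4 τ (x - e₄)
      = -(theta1 τ (2 * x) * theta1 τ (e₁ + e₂) * theta1 τ (e₁ + e₃) * theta1 τ (e₁ + e₄)) := by
  have h := theta1111_sub hτ he (x + τ / 2)
  have s : ∀ e, x + τ / 2 + e = x + e + τ / 2 := fun e => by ring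
  have s' : ∀ e, x + τ / 2 - e = x - e + τ / 2 := fun e => by ring
  rw [show 2 * (x + τ / 2) = 2 * x + τ by ring, theta1_add_tau] at h
  simp only [s, s', theta1_add_tau_half] at h
  set c : ℂ → ℂ := fun z => exp (-(Real.pi * I * τ / 4) - Real.pi * I * z) with hc
  set M := exp (-(Real.pi * I * τ) - 2 * Real.pi * I * (2 * x)) with hM
  have h1 : c (x + e₁) * c (x + e₂) * c (x + e₃) * c (x + e₄) = M := by
    simp only [hc, hM, ← exp_add]
    congr 1; linear_combination (-(Real.pi * I)) * he
  have h2 : c (x - e₁) * c (x - e₂) * c (x - e₃) * c (x - e₄) = M := by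
    simp only [hc, hM, ← exp_add]
    congr 1; linear_combination (Real.pi * I) * he
  refine mul_left_cancel₀ (exp_ne_zero _ : M ≠ 0) ?_
  have hI : I ^ 4 = 1 := I_pow_four
  simp only [hc] at h1 h2
  linear_combination h
    - (theta4 τ (x + e₁) * theta4 τ (x + e₂) * theta4 τ (x + e₃) * theta4 τ (x + e₄)) * (h1)
    + (theta4 τ (x - e₁) * theta4 τ (x - e₂) * theta4 τ (x - e₃) * theta4 τ (x - e₄)) * (h2)
    - (c (x + e₁) * c (x + e₂) * c (x + e₃) * c (x + e₄) * (theta4 τ (x + e₁) * theta4 τ (x + e₂)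
      * theta4 τ (x + e₃) * theta4 τ (x + e₄))
      - c (x - e₁) * c (x - e₂) * c (x - e₃) * c (x - e₄) * (theta4 τ (x - e₁) * theta4 τ (x - e₂)
      * theta4 τ (x - e₃) * theta4 τ (x - e₄))) * hI

/-- Here `e₁` and `e₂` are shifted by opposite half periods, which preserves the zero sum. -/
lemma theta4411_sub (hτ : 0 < τ.im) {e₁ e₂ e₃ e₄ : ℂ} (he : e₁ + e₂ + e₃ + e₄ = 0) (x : ℂ) :
    theta4 τ (x + e₁) * theta4 τ (x + e₂) * theta1 τ (x + e₃) * theta1 τ (x + e₄)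
      - theta4 τ (x - e₁) * theta4 τ (x - e₂) * theta1 τ (x - e₃) * theta1 τ (x - e₄)
      = -(theta1 τ (2 * x) * theta1 τ (e₁ + e₂) * theta4 τ (e₁ + e₃) * theta4 τ (e₁ + e₄)) := by
  have h := theta1111_sub hτ (e₁ := e₁ + τ / 2) (e₂ := e₂ - τ / 2) (e₃ := e₃) (e₄ := e₄)
    (by linear_combination he) x
  rw [show x + (e₁ + τ / 2) = x + e₁ + τ / 2 by ring, show x + (e₂ - τ / 2) = x + e₂ - τ / 2 by ring,
    show x - (e₁ + τ / 2) = x - e₁ - τ / 2 by ring, show x - (e₂ - τ / 2) = x - e₂ + τ / 2 by ring,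
    show e₁ + τ / 2 + (e₂ - τ / 2) = e₁ + e₂ by ring, show e₁ + τ / 2 + e₃ = e₁ + e₃ + τ / 2 by ring,
    show e₁ + τ / 2 + e₄ = e₁ + e₄ + τ / 2 by ring] at h
  simp only [theta1_add_tau_half, theta1_sub_tau_half] at h
  set M := exp (-(Real.pi * I * τ / 2) - Real.pi * I * (e₁ - e₂)) with hM
  have h1 : exp (-(Real.pi * I * τ / 4) - Real.pi * I * (x + e₁))
      * exp (-(Real.pi * I * τ / 4) + Real.pi * I * (x + e₂)) = M := by
    simp only [hM, ← exp_add]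
    congr 1; ring
  have h2 : exp (-(Real.pi * I * τ / 4) + Real.pi * I * (x - e₁))
      * exp (-(Real.pi * I * τ / 4) - Real.pi * I * (x - e₂)) = M := by
    simp only [hM, ← exp_add]
    congr 1; ring
  have h3 : exp (-(Real.pi * I * τ / 4) - Real.pi * I * (e₁ + e₃))
      * exp (-(Real.pi * I * τ / 4) - Real.pi * I * (e₁ + e₄)) = M := by
    simp only [hM, ← exp_add]
    congr 1; linear_combination (-(Real.pi * I)) * he
  refine mul_left_cancel₀ (exp_ne_zero _ : M ≠ 0) ?_
  set A := theta4 τ (x + e₁) * theta4 τ (x + e₂) * theta1 τ (x + e₃) * theta1 τ (x + e₄)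
  set B := theta4 τ (x - e₁) * theta4 τ (x - e₂) * theta1 τ (x - e₃) * theta1 τ (x - e₄)
  set C := theta1 τ (2 * x) * theta1 τ (e₁ + e₂) * theta4 τ (e₁ + e₃) * theta4 τ (e₁ + e₄)
  have hI := I_sq
  have h' : -I ^ 2 * (M * A) + I ^ 2 * (M * B) = I ^ 2 * (M * C) := by
    conv_lhs => rw [← h1]
    conv_lhs => rw [h1]
    linear_combination h - I ^ 2 * A * (-h1) - I ^ 2 * B * h2 + I ^ 2 * C * h3
  rw [hI] at h'
  linear_combination h'

/-- `θ₁(2x) / θ₁(x)` as an entire function. -/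
def thetaDup (τ x : ℂ) : ℂ :=
  2 * theta2 τ x * theta3 τ x * theta4 τ x / (theta2 τ 0 * theta3 τ 0 * theta4 τ 0)

/-- Take the `eᵢ` to be `0` and three half periods of zero sum. By parity the two quartic products
are then negatives of each other. -/
lemma theta1_two_mul_mul (hτ : 0 < τ.im) (x : ℂ) :
    theta1 τ (2 * x) * (theta2 τ 0 * theta3 τ 0 * theta4 τ 0)
      = 2 * theta1 τ x * theta2 τ x * theta3 τ x * theta4 τ x := by
  have h := theta1111_sub hτ (e₁ := 0) (e₂ := 1 / 2) (e₃ := τ / 2) (e₄ := -(1 / 2) - τ / 2)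
    (by ring) x
  have key : ∀ z, theta1 τ (z + (-(1 / 2) - τ / 2))
      = -(exp (-(Real.pi * I * τ / 4) + Real.pi * I * z) * theta3 τ z) := fun z => by
    rw [show z + (-(1 / 2) - τ / 2) = -(-z + τ / 2 + 1 / 2) by ring, theta1_neg, theta1_add_half,
      theta2_add_tau_half, theta3_neg]
    congr 3; ring
  have m : ∀ e, theta1 τ (x - e) = -theta1 τ (-x + e) := fun e => by
    rw [← theta1_neg]; congr 1; ring
  simp only [m, key, add_zero, theta1_add_half, theta1_add_tau_half, theta1_neg, theta2_neg,
    theta3_neg, theta4_neg] at h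
  simp only [mul_neg, sub_neg_eq_add, mul_zero, sub_zero, ← sub_eq_add_neg] at h
  have h1 : exp (-(Real.pi * I * τ / 4) - Real.pi * I * x)
      * exp (-(Real.pi * I * τ / 4) + Real.pi * I * x) = exp (-(Real.pi * I * τ / 2)) := by
    simp only [← exp_add]; congr 1; ring
  have h2 : exp (-(Real.pi * I * τ / 4)) * exp (-(Real.pi * I * τ / 4))
      = exp (-(Real.pi * I * τ / 2)) := by
    simp only [← exp_add]; congr 1; ring
  refine mul_left_cancel₀ (mul_ne_zero I_ne_zero (exp_ne_zero (-(Real.pi * I * τ / 2)))) ?_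
  simp only [add_zero] at h
  linear_combination h + 2 * I * theta1 τ x * theta2 τ x * theta3 τ x * theta4 τ x * h1
    - I * theta1 τ (2 * x) * theta2 τ 0 * theta3 τ 0 * theta4 τ 0 * h2

/-- Otherwise the duplication formula would force `θ₁θ₂θ₃θ₄` to vanish identically, although each
factor has isolated zeros. -/
lemma theta_zero_ne_zero (hτ : 0 < τ.im) : theta2 τ 0 * theta3 τ 0 * theta4 τ 0 ≠ 0 := by
  intro h0
  obtain ⟨z, h1, h2, h3, h4⟩ := ((eventually_theta1_ne_zero hτ 0).and
    ((eventually_theta2_ne_zero hτ 0).and ((eventually_theta3_ne_zero hτ 0).and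
      (eventually_theta4_ne_zero hτ 0)))).exists
  have h := theta1_two_mul_mul hτ z
  rw [h0, mul_zero, eq_comm] at h
  simp [h1, h2, h3, h4] at h

lemma theta2_zero_ne_zero (hτ : 0 < τ.im) : theta2 τ 0 ≠ 0 := fun h =>
  theta_zero_ne_zero hτ (by rw [h]; ring)

lemma theta3_zero_ne_zero (hτ : 0 < τ.im) : theta3 τ 0 ≠ 0 := fun h =>
  theta_zero_ne_zero hτ (by rw [h]; ring)

lemma theta4_zero_ne_zero (hτ : 0 < τ.im) : theta4 τ 0 ≠ 0 := fun h =>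
  theta_zero_ne_zero hτ (by rw [h]; ring)

lemma theta1_two_mul (hτ : 0 < τ.im) (x : ℂ) :
    theta1 τ (2 * x) = thetaDup τ x * theta1 τ x := by
  have h := theta1_two_mul_mul hτ x
  rw [thetaDup, div_mul_eq_mul_div, eq_div_iff (theta_zero_ne_zero hτ), h]
  ring

lemma eventually_thetaDup_ne_zero (hτ : 0 < τ.im) (x : ℂ) :
    ∀ᶠ z in 𝓝[≠] x, thetaDup τ z ≠ 0 := by
  filter_upwards [eventually_theta2_ne_zero hτ x, eventually_theta3_ne_zero hτ x,
    eventually_theta4_ne_zero hτ x] with z h2 h3 h4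
  have := theta_zero_ne_zero hτ
  exact div_ne_zero (by simp [h2, h3, h4]) this

lemma continuous_thetaDup (hτ : 0 < τ.im) : Continuous (thetaDup τ) := by
  have h2 := (differentiable_theta2 hτ).continuous
  have h3 := (differentiable_theta3 hτ).continuous
  have h4 := (differentiable_theta4 hτ).continuous
  unfold thetaDup
  fun_prop

lemma theta1_mul_left_cancel (hτ : 0 < τ.im) {f g : ℂ → ℂ} (hf : Continuous f) (hg : Continuous g)
    (h : ∀ z, theta1 τ z * f z = theta1 τ z * g z) (z : ℂ) : f z = g z :=
  eq_of_eventuallyEq_nhdsNE hf.continuousAt hg.continuousAt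
    ((eventually_theta1_ne_zero hτ z).mono fun w hw => mul_left_cancel₀ hw (h w))

/-! ### Cubic identities -/

/-- All cubic identities are quartic ones with one shift equal to zero. A common factor `θ₁(x)`
cancels against `θ₁(2x)`; a common factor `θ₄(x)`, as here, stays. -/
lemma theta444_sub (hτ : 0 < τ.im) {e₁ e₂ e₃ : ℂ} (he : e₁ + e₂ + e₃ = 0) (x : ℂ) :
    theta4 τ x * (theta4 τ (x + e₁) * theta4 τ (x + e₂) * theta4 τ (x + e₃)
      - theta4 τ (x - e₁) * theta4 τ (x - e₂) * theta4 τ (x - e₃))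
      = -(thetaDup τ x * theta1 τ x * theta1 τ e₁ * theta1 τ e₂ * theta1 τ e₃) := by
  have h := theta4444_sub hτ (e₁ := e₁) (e₂ := e₂) (e₃ := e₃) (e₄ := 0) (by rw [he, add_zero]) x
  rw [show e₁ + e₂ = -e₃ by linear_combination he, show e₁ + e₃ = -e₂ by linear_combination he,
    theta1_neg, theta1_neg, theta1_two_mul hτ] at h
  simp only [add_zero, sub_zero] at h
  linear_combination h

lemma theta441_sub (hτ : 0 < τ.im) {e₁ e₂ e₃ : ℂ} (he : e₁ + e₂ + e₃ = 0) (x : ℂ) :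
    theta4 τ (x + e₁) * theta4 τ (x + e₂) * theta1 τ (x + e₃)
      - theta4 τ (x - e₁) * theta4 τ (x - e₂) * theta1 τ (x - e₃)
      = thetaDup τ x * theta4 τ e₁ * theta4 τ e₂ * theta1 τ e₃ := by
  have h1 := (differentiable_theta1 hτ).continuous
  have h4 := (differentiable_theta4 hτ).continuous
  have hd := continuous_thetaDup hτ
  refine theta1_mul_left_cancel hτ (f := fun x =>
    theta4 τ (x + e₁) * theta4 τ (x + e₂) * theta1 τ (x + e₃)
      - theta4 τ (x - e₁) * theta4 τ (x - e₂) * theta1 τ (x - e₃))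
    (g := fun x => thetaDup τ x * theta4 τ e₁ * theta4 τ e₂ * theta1 τ e₃)
    (by fun_prop) (by fun_prop) (fun x => ?_) x
  have h := theta4411_sub hτ (e₁ := e₁) (e₂ := e₂) (e₃ := e₃) (e₄ := 0) (by rw [he, add_zero]) x
  rw [show e₁ + e₂ = -e₃ by linear_combination he, show e₁ + e₃ = -e₂ by linear_combination he,
    theta1_neg, theta4_neg, theta1_two_mul hτ] at h
  simp only [add_zero, sub_zero] at h
  linear_combination h

lemma theta411_sub (hτ : 0 < τ.im) {e₁ e₂ e₃ : ℂ} (he : e₁ + e₂ + e₃ = 0) (x : ℂ) :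
    theta4 τ x * (theta4 τ (x + e₁) * theta1 τ (x + e₂) * theta1 τ (x + e₃)
      - theta4 τ (x - e₁) * theta1 τ (x - e₂) * theta1 τ (x - e₃))
      = -(thetaDup τ x * theta1 τ x * theta1 τ e₁ * theta4 τ e₂ * theta4 τ e₃) := by
  have h := theta4411_sub hτ (e₁ := e₁) (e₂ := 0) (e₃ := e₂) (e₄ := e₃)
    (by linear_combination he) x
  rw [show e₁ + e₂ = -e₃ by linear_combination he, show e₁ + e₃ = -e₂ by linear_combination he,
    theta4_neg, theta4_neg, theta1_two_mul hτ] at h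
  simp only [add_zero, sub_zero] at h
  linear_combination h

lemma theta111_sub (hτ : 0 < τ.im) {e₁ e₂ e₃ : ℂ} (he : e₁ + e₂ + e₃ = 0) (x : ℂ) :
    theta1 τ (x + e₁) * theta1 τ (x + e₂) * theta1 τ (x + e₃)
      - theta1 τ (x - e₁) * theta1 τ (x - e₂) * theta1 τ (x - e₃)
      = thetaDup τ x * theta1 τ e₁ * theta1 τ e₂ * theta1 τ e₃ := by
  have h1 := (differentiable_theta1 hτ).continuous
  have hd := continuous_thetaDup hτ
  refine theta1_mul_left_cancel hτ (f := fun x =>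
    theta1 τ (x + e₁) * theta1 τ (x + e₂) * theta1 τ (x + e₃)
      - theta1 τ (x - e₁) * theta1 τ (x - e₂) * theta1 τ (x - e₃))
    (g := fun x => thetaDup τ x * theta1 τ e₁ * theta1 τ e₂ * theta1 τ e₃)
    (by fun_prop) (by fun_prop) (fun x => ?_) x
  have h := theta1111_sub hτ (e₁ := e₁) (e₂ := e₂) (e₃ := e₃) (e₄ := 0) (by rw [he, add_zero]) x
  rw [show e₁ + e₂ = -e₃ by linear_combination he, show e₁ + e₃ = -e₂ by linear_combination he,
    theta1_neg, theta1_neg, theta1_two_mul hτ] at h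
  simp only [add_zero, sub_zero] at h
  linear_combination h

/-! ### Expansion of products of two shifted theta functions -/

/-- A quartic identity based at `x/2`. It writes the product through two functions of `x` that
depend on `c`, `d` only via `c + d`, so two shifts can be merged into one. -/
lemma theta4_mul_expand (hτ : 0 < τ.im) (c d x : ℂ) :
    theta4 τ 0 * theta4 τ (c + d) * (theta4 τ (x - c) * theta4 τ (x - d))
      = theta4 τ c * theta4 τ d * (theta4 τ x * theta4 τ (x - (c + d)))
        + theta1 τ c * theta1 τ d * (theta1 τ x * theta1 τ (x - (c + d))) := by
  have h := theta4444_sub hτ (e₁ := x / 2) (e₂ := x / 2 - (c + d)) (e₃ := c - x / 2)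
    (e₄ := d - x / 2) (by ring) (x / 2)
  rw [show x / 2 + x / 2 = x by ring, show x / 2 + (x / 2 - (c + d)) = x - (c + d) by ring,
    show x / 2 + (c - x / 2) = c by ring, show x / 2 + (d - x / 2) = d by ring,
    sub_self, show x / 2 - (x / 2 - (c + d)) = c + d by ring,
    show x / 2 - (c - x / 2) = x - c by ring, show x / 2 - (d - x / 2) = x - d by ring,
    mul_div_cancel₀ _ (two_ne_zero' ℂ)] at h
  linear_combination -h

lemma theta1_mul_expand (hτ : 0 < τ.im) (c d x : ℂ) :
    theta4 τ 0 * theta4 τ (c + d) * (theta1 τ (x - c) * theta1 τ (x - d))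
      = theta4 τ c * theta4 τ d * (theta1 τ x * theta1 τ (x - (c + d)))
        + theta1 τ c * theta1 τ d * (theta4 τ x * theta4 τ (x - (c + d))) := by
  have h := theta4411_sub hτ (e₁ := x / 2) (e₂ := x / 2 - (c + d)) (e₃ := c - x / 2)
    (e₄ := d - x / 2) (by ring) (x / 2)
  rw [show x / 2 + x / 2 = x by ring, show x / 2 + (x / 2 - (c + d)) = x - (c + d) by ring,
    show x / 2 + (c - x / 2) = c by ring, show x / 2 + (d - x / 2) = d by ring,
    sub_self, show x / 2 - (x / 2 - (c + d)) = c + d by ring,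
    show x / 2 - (c - x / 2) = x - c by ring, show x / 2 - (d - x / 2) = x - d by ring,
    mul_div_cancel₀ _ (two_ne_zero' ℂ)] at h
  linear_combination -h

/-- The case `d = -c` of the expansion with `c` a half period; classically `dn² = 1 - k² sn²`. -/
lemma theta3_sq_mul (hτ : 0 < τ.im) (x : ℂ) :
    theta4 τ 0 ^ 2 * theta3 τ x ^ 2
      = theta3 τ 0 ^ 2 * theta4 τ x ^ 2 - theta2 τ 0 ^ 2 * theta1 τ x ^ 2 := by
  have h := theta4_mul_expand hτ (1 / 2) (-(1 / 2)) x
  have h1 := theta1_add_half (τ := τ) 0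
  have h4 := theta4_add_half (τ := τ) 0
  have hm := theta4_add_one (τ := τ) (x - 1 / 2)
  rw [zero_add] at h1 h4
  rw [show x - 1 / 2 + 1 = x + 1 / 2 by ring] at hm
  rw [theta4_neg, theta1_neg, h1, h4, ← hm, add_neg_cancel, sub_zero, sub_neg_eq_add,
    theta4_add_half] at h
  linear_combination h

lemma theta2_sq_mul (hτ : 0 < τ.im) (x : ℂ) :
    theta4 τ 0 ^ 2 * theta2 τ x ^ 2
      = theta2 τ 0 ^ 2 * theta4 τ x ^ 2 - theta3 τ 0 ^ 2 * theta1 τ x ^ 2 := by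
  have h := theta4_mul_expand hτ (τ / 2 + 1 / 2) (-(τ / 2 + 1 / 2)) x
  have key : ∀ z, theta4 τ (z + (τ / 2 + 1 / 2))
      = exp (-(Real.pi * I * τ / 4) - Real.pi * I * z) * theta2 τ z := fun z => by
    rw [← add_assoc, theta4_add_half, theta3_add_tau_half]
  have key' : ∀ z, theta1 τ (z + (τ / 2 + 1 / 2))
      = exp (-(Real.pi * I * τ / 4) - Real.pi * I * z) * theta3 τ z := fun z => by
    rw [← add_assoc, theta1_add_half, theta2_add_tau_half]
  have k4 := key 0
  have k1 := key' 0
  have km : theta4 τ (x - (τ / 2 + 1 / 2))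
      = exp (-(Real.pi * I * τ / 4) + Real.pi * I * x) * theta2 τ x := by
    rw [← theta4_neg, neg_sub, ← neg_add_eq_sub, add_comm (-x), add_comm _ (-x), key, theta2_neg]
    congr 2; ring
  rw [zero_add, mul_zero, sub_zero] at k1 k4
  rw [theta4_neg, theta1_neg, k1, k4, km, add_neg_cancel, sub_zero, sub_neg_eq_add, key] at h
  have h1 : exp (-(Real.pi * I * τ / 4) + Real.pi * I * x)
      * exp (-(Real.pi * I * τ / 4) - Real.pi * I * x) = exp (-(Real.pi * I * τ / 4)) ^ 2 := by
    rw [sq]; simp only [← exp_add]; congr 1; ring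
  refine mul_left_cancel₀ (pow_ne_zero 2 (exp_ne_zero (-(Real.pi * I * τ / 4)))) ?_
  linear_combination h - theta4 τ 0 ^ 2 * theta2 τ x ^ 2 * h1

end Theta

section Legs

variable {τ : ℂ}

/-! ### Quartic identities of odd type -/

/-- Products with an odd number of `θ₁` are not reached from the Weierstrass relation by half-period
shifts of zero sum. Merging the shifts `e₁`, `e₂` reduces them to cubic identities with shifts `e₁ +
e₂`, `e₃`, `e₄`, at the price of dividing by `θ₄(e₁ + e₂)`. -/
lemma theta4441_sub (hτ : 0 < τ.im) {e₁ e₂ e₃ e₄ : ℂ} (he : e₁ + e₂ + e₃ + e₄ = 0)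
    (h₁₂ : theta4 τ (e₁ + e₂) ≠ 0) (x : ℂ) :
    theta4 τ 0 * theta4 τ x
      * (theta4 τ (x + e₁) * theta4 τ (x + e₂) * theta4 τ (x + e₃) * theta1 τ (x + e₄)
        - theta4 τ (x - e₁) * theta4 τ (x - e₂) * theta4 τ (x - e₃) * theta1 τ (x - e₄))
      = thetaDup τ x * (theta4 τ x ^ 2 * (theta4 τ e₁ * theta4 τ e₂ * theta4 τ e₃ * theta1 τ e₄)
        - theta1 τ x ^ 2 * (theta1 τ e₁ * theta1 τ e₂ * theta1 τ e₃ * theta4 τ e₄)) := by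
  have hp := theta4_mul_expand hτ (-e₁) (-e₂) x
  have hm := theta4_mul_expand hτ e₁ e₂ x
  rw [← neg_add, theta4_neg, theta4_neg, theta4_neg, theta1_neg, theta1_neg, sub_neg_eq_add,
    sub_neg_eq_add, sub_neg_eq_add] at hp
  have h441 := theta441_sub hτ (e₁ := e₁ + e₂) (e₂ := e₃) (e₃ := e₄) he x
  have h411 := theta411_sub hτ (e₁ := e₃) (e₂ := e₁ + e₂) (e₃ := e₄) (by linear_combination he) x
  refine mul_left_cancel₀ h₁₂ ?_
  linear_combination theta4 τ x * theta4 τ (x + e₃) * theta1 τ (x + e₄) * hp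
    - theta4 τ x * theta4 τ (x - e₃) * theta1 τ (x - e₄) * hm
    + theta4 τ e₁ * theta4 τ e₂ * theta4 τ x ^ 2 * h441
    + theta1 τ e₁ * theta1 τ e₂ * theta1 τ x * h411

lemma theta1114_sub (hτ : 0 < τ.im) {e₁ e₂ e₃ e₄ : ℂ} (he : e₁ + e₂ + e₃ + e₄ = 0)
    (h₁₂ : theta4 τ (e₁ + e₂) ≠ 0) (x : ℂ) :
    theta4 τ 0 * theta4 τ x
      * (theta1 τ (x + e₁) * theta1 τ (x + e₂) * theta1 τ (x + e₃) * theta4 τ (x + e₄)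
        - theta1 τ (x - e₁) * theta1 τ (x - e₂) * theta1 τ (x - e₃) * theta4 τ (x - e₄))
      = thetaDup τ x * (theta4 τ x ^ 2 * (theta1 τ e₁ * theta1 τ e₂ * theta1 τ e₃ * theta4 τ e₄)
        - theta1 τ x ^ 2 * (theta4 τ e₁ * theta4 τ e₂ * theta4 τ e₃ * theta1 τ e₄)) := by
  have hp := theta1_mul_expand hτ (-e₁) (-e₂) x
  have hm := theta1_mul_expand hτ e₁ e₂ x
  rw [← neg_add, theta4_neg, theta4_neg, theta4_neg, theta1_neg, theta1_neg, sub_neg_eq_add,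
    sub_neg_eq_add, sub_neg_eq_add] at hp
  have h441 := theta441_sub hτ (e₁ := e₁ + e₂) (e₂ := e₄) (e₃ := e₃) (by linear_combination he) x
  have h411 := theta411_sub hτ (e₁ := e₄) (e₂ := e₁ + e₂) (e₃ := e₃) (by linear_combination he) x
  refine mul_left_cancel₀ h₁₂ ?_
  linear_combination theta4 τ x * theta1 τ (x + e₃) * theta4 τ (x + e₄) * hp
    - theta4 τ x * theta1 τ (x - e₃) * theta4 τ (x - e₄) * hm
    + theta4 τ e₁ * theta4 τ e₂ * theta1 τ x * h411
    + theta1 τ e₁ * theta1 τ e₂ * theta4 τ x ^ 2 * h441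

/-! ### The normalised elliptic sine, legs and the three-leg form of Q4 -/

/-- The normalised elliptic sine `√k sn = θ₁ / θ₄`. -/
def thetaRatio (τ z : ℂ) : ℂ := theta1 τ z / theta4 τ z

lemma thetaRatio_neg (z : ℂ) : thetaRatio τ (-z) = -thetaRatio τ z := by
  rw [thetaRatio, thetaRatio, theta1_neg, theta4_neg, neg_div]

lemma theta1_eq_thetaRatio_mul {z : ℂ} (h : theta4 τ z ≠ 0) :
    theta1 τ z = thetaRatio τ z * theta4 τ z := by
  rw [thetaRatio, div_mul_cancel₀ _ h]

/-- A leg, as an entire function: `θ₄(p) x - θ₁(p)`. -/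
def leg (τ p x : ℂ) : ℂ := theta4 τ p * x - theta1 τ p

/-- The coefficient of `z` in Q4 with normalised parameters. -/
def quadLead (A B C w x y : ℂ) : ℂ := A * y - B * x - C * w + A * B * C * w * x * y

/-- The part of Q4 with normalised parameters that does not contain `z`. -/
def quadConst (A B C w x y : ℂ) : ℂ := A * w * x - B * w * y - C * x * y + A * B * C

/-- Q4 with normalised parameters `A`, `B`, `C` for `√k sn a`, `√k sn b`, `√k sn (a - b)`. -/
def quad (A B C w x y z : ℂ) : ℂ := quadLead A B C w x y * z + quadConst A B C w x y

/-- Both sides are affine in each of `x`, `y`, `z`. Each of the eight coefficients is a cubic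
identity with shifts `a`, `-b`, `-(a - b)`. -/
lemma three_leg (hτ : 0 < τ.im) {a b ξ : ℂ} (hξ : theta4 τ ξ ≠ 0) (ha : theta4 τ a ≠ 0)
    (hb : theta4 τ b ≠ 0) (hab : theta4 τ (a - b) ≠ 0) (x y z : ℂ) :
    leg τ (ξ + a) x * leg τ (ξ - b) y * leg τ (ξ - (a - b)) z
      - leg τ (ξ - a) x * leg τ (ξ + b) y * leg τ (ξ + (a - b)) z
      = -(thetaDup τ ξ * (theta4 τ a * theta4 τ b * theta4 τ (a - b))
        * quad (thetaRatio τ a) (thetaRatio τ b) (thetaRatio τ (a - b)) (thetaRatio τ ξ) x y z) := by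
  have e : ∀ c : ℂ, ξ - c = ξ + -c := fun c => sub_eq_add_neg _ _
  have e' : ∀ c : ℂ, ξ - -c = ξ + c := fun c => sub_neg_eq_add _ _
  have h444 := theta444_sub hτ (e₁ := a) (e₂ := -b) (e₃ := -(a - b)) (by ring) ξ
  have hx := theta441_sub hτ (e₁ := -b) (e₂ := -(a - b)) (e₃ := a) (by ring) ξ
  have hy := theta441_sub hτ (e₁ := a) (e₂ := -(a - b)) (e₃ := -b) (by ring) ξ
  have hz := theta441_sub hτ (e₁ := a) (e₂ := -b) (e₃ := -(a - b)) (by ring) ξ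
  have kx := theta411_sub hτ (e₁ := a) (e₂ := -b) (e₃ := -(a - b)) (by ring) ξ
  have ky := theta411_sub hτ (e₁ := -b) (e₂ := a) (e₃ := -(a - b)) (by ring) ξ
  have kz := theta411_sub hτ (e₁ := -(a - b)) (e₂ := a) (e₃ := -b) (by ring) ξ
  have h111 := theta111_sub hτ (e₁ := a) (e₂ := -b) (e₃ := -(a - b)) (by ring) ξ
  simp only [e', ← e, theta1_neg, theta4_neg, theta1_eq_thetaRatio_mul ha,
    theta1_eq_thetaRatio_mul hb, theta1_eq_thetaRatio_mul hab, theta1_eq_thetaRatio_mul hξ]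
    at h444 hx hy hz kx ky kz h111
  refine mul_left_cancel₀ hξ ?_
  simp only [leg, quad, quadLead, quadConst]
  linear_combination x * y * z * h444 - theta4 τ ξ * (y * z * hx + x * z * hy + x * y * hz)
    + x * kx + y * ky + z * kz - theta4 τ ξ * h111

/-- The determinant of the legs at `ξ ± c`, as affine functions of one variable. It allows a quad
equation to be solved for each long leg, and its vanishing makes the two legs proportional. -/
lemma leg_wronskian (hτ : 0 < τ.im) (c ξ : ℂ) :
    theta4 τ ξ * (theta4 τ (ξ + c) * theta1 τ (ξ - c) - theta4 τ (ξ - c) * theta1 τ (ξ + c))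
      = -(thetaDup τ ξ * (theta4 τ 0 * theta4 τ c * theta1 τ c)) := by
  have h := theta441_sub hτ (e₁ := c) (e₂ := 0) (e₃ := -c) (by ring) ξ
  simp only [add_zero, sub_zero, theta1_neg, sub_neg_eq_add, ← sub_eq_add_neg] at h
  linear_combination h

/-! ### The five-point relation at a vertex with two equal diagonal neighbours -/

/-- The left-hand side of the elliptic difference equation with normalised coefficients. -/
def ellPoly (f₁ f₂ f₃ f₄ g a b m u p : ℂ) : ℂ :=
  ((1 - f₁ * f₂ * f₃ * f₄) * g * a * b - f₁ * f₂ * f₄ - f₁ * f₂ * f₃) * (u - m * u ^ 3 * p)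
    + f₁ * f₃ * f₄ * (m - p * u ^ 4) + f₂ * f₃ * f₄ * (p - m * u ^ 4)
    + (f₁ - f₂ - (1 - f₁ * f₂ * f₃ * f₄) * (a - b)) * (m * u ^ 2 - p * u ^ 2)
    - (f₄ + f₃ - (1 - f₁ * f₂ * f₃ * f₄) * g) * (m * u * p - u ^ 3)

/-- The elliptic difference equation with parameters measured in units of `2 K`. -/
def ellRel (τ γ a b m u p : ℂ) : ℂ :=
  ellPoly (thetaRatio τ (γ + a - b)) (thetaRatio τ (γ - a + b)) (thetaRatio τ (γ - a - b))
    (thetaRatio τ (γ + a + b)) (thetaRatio τ (2 * γ)) (thetaRatio τ (2 * a)) (thetaRatio τ (2 * b))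
    m u p

/-- All theta functions in the denominators of the coefficients are nonzero. -/
def CoeffFinite (τ γ a b : ℂ) : Prop :=
  theta4 τ (2 * γ) ≠ 0 ∧ theta4 τ (2 * a) ≠ 0 ∧ theta4 τ (2 * b) ≠ 0 ∧
  theta4 τ (γ + a - b) ≠ 0 ∧ theta4 τ (γ - a + b) ≠ 0 ∧
  theta4 τ (γ - a - b) ≠ 0 ∧ theta4 τ (γ + a + b) ≠ 0

/-- The four shifts, two taken with a minus sign, add up to zero. Hence each of the sixteen
coefficients of the expanded product in `p`, `m` and two copies of `u` is a quartic identity, of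
even or of odd type. -/
lemma toda_eq_ellRel (hτ : 0 < τ.im) {γ a b ξ : ℂ} (hξ : theta4 τ ξ ≠ 0)
    (hc : CoeffFinite τ γ a b) (m p : ℂ) :
    theta4 τ 0 *
    (leg τ (ξ + (γ + a - b)) p * leg τ (ξ + (γ - a + b)) m
        * leg τ (ξ - (γ - a - b)) (thetaRatio τ ξ) * leg τ (ξ - (γ + a + b)) (thetaRatio τ ξ)
      - leg τ (ξ - (γ + a - b)) p * leg τ (ξ - (γ - a + b)) m
        * leg τ (ξ + (γ - a - b)) (thetaRatio τ ξ) * leg τ (ξ + (γ + a + b)) (thetaRatio τ ξ))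
    = -(thetaDup τ ξ * theta4 τ ξ * (theta4 τ (γ + a - b) * theta4 τ (γ - a + b)
        * theta4 τ (γ - a - b) * theta4 τ (γ + a + b)) * ellRel τ γ a b m (thetaRatio τ ξ) p) := by
  obtain ⟨hγ, ha, hb, h₁, h₂, h₃, h₄⟩ := hc
  -- Source of the factor `1 - kω`: it equals `θ₄(0) θ₄(2γ) θ₄(2a) θ₄(2b)` divided by the product of
  -- `θ₄` over the four shifts.
  have hω := theta4_mul_expand hτ (γ + a - b) (γ - a + b) (γ - a - b)
  unfold ellRel
  set c₁ := γ + a - b with hc₁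
  set c₂ := γ - a + b with hc₂
  set c₃ := γ - a - b with hc₃
  set c₄ := γ + a + b with hc₄
  have s12 : c₁ + c₂ = 2 * γ := by rw [hc₁, hc₂]; ring
  have s12' : c₂ + c₁ = 2 * γ := by rw [hc₁, hc₂]; ring
  have s34 : -c₃ + -c₄ = -(2 * γ) := by rw [hc₃, hc₄]; ring
  have s13 : c₁ + -c₃ = 2 * a := by rw [hc₁, hc₃]; ring
  have s31 : -c₃ + c₁ = 2 * a := by rw [hc₁, hc₃]; ring
  have s14 : c₁ + -c₄ = -(2 * b) := by rw [hc₁, hc₄]; ring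
  have s23 : c₂ + -c₃ = 2 * b := by rw [hc₂, hc₃]; ring
  have s32 : -c₃ + c₂ = 2 * b := by rw [hc₂, hc₃]; ring
  have s24 : c₂ + -c₄ = -(2 * a) := by rw [hc₂, hc₄]; ring
  have t1 : c₃ - c₁ = -(2 * a) := by rw [hc₁, hc₃]; ring
  have t2 : c₃ - c₂ = -(2 * b) := by rw [hc₂, hc₃]; ring
  have t3 : c₃ - 2 * γ = -c₄ := by rw [hc₃, hc₄]; ring
  have hγ' : theta4 τ (-(2 * γ)) ≠ 0 := by rwa [theta4_neg]
  rw [s12, t1, t2, t3] at hω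
  clear_value c₁ c₂ c₃ c₄
  -- The digits say, for `c₁, c₂, c₃, c₄` in turn, whether a leg contributes its leading coefficient
  -- `θ₄` or its constant term `θ₁`.
  have D4444 := theta4444_sub hτ (e₁ := c₁) (e₂ := c₂) (e₃ := -c₃) (e₄ := -c₄)
    (by linear_combination s12 + s34) ξ
  have D1111 := theta1111_sub hτ (e₁ := c₁) (e₂ := c₂) (e₃ := -c₃) (e₄ := -c₄)
    (by linear_combination s12 + s34) ξ
  have D4411 := theta4411_sub hτ (e₁ := c₁) (e₂ := c₂) (e₃ := -c₃) (e₄ := -c₄)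
    (by linear_combination s12 + s34) ξ
  have D1144 := theta4411_sub hτ (e₁ := -c₃) (e₂ := -c₄) (e₃ := c₁) (e₄ := c₂)
    (by linear_combination s12 + s34) ξ
  have D4141 := theta4411_sub hτ (e₁ := c₁) (e₂ := -c₃) (e₃ := c₂) (e₄ := -c₄)
    (by linear_combination s12 + s34) ξ
  have D1414 := theta4411_sub hτ (e₁ := c₂) (e₂ := -c₄) (e₃ := c₁) (e₄ := -c₃)
    (by linear_combination s12 + s34) ξ
  have D4114 := theta4411_sub hτ (e₁ := c₁) (e₂ := -c₄) (e₃ := c₂) (e₄ := -c₃)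
    (by linear_combination s12 + s34) ξ
  have D1441 := theta4411_sub hτ (e₁ := c₂) (e₂ := -c₃) (e₃ := c₁) (e₄ := -c₄)
    (by linear_combination s12 + s34) ξ
  have D4441 := theta4441_sub hτ (e₁ := c₁) (e₂ := c₂) (e₃ := -c₃) (e₄ := -c₄)
    (by linear_combination s12 + s34) (by rwa [s12]) ξ
  have D4414 := theta4441_sub hτ (e₁ := c₁) (e₂ := c₂) (e₃ := -c₄) (e₄ := -c₃)
    (by linear_combination s12 + s34) (by rwa [s12]) ξ
  have D4144 := theta4441_sub hτ (e₁ := -c₃) (e₂ := -c₄) (e₃ := c₁) (e₄ := c₂)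
    (by linear_combination s12 + s34) (by rwa [s34]) ξ
  have D1444 := theta4441_sub hτ (e₁ := -c₃) (e₂ := -c₄) (e₃ := c₂) (e₄ := c₁)
    (by linear_combination s12 + s34) (by rwa [s34]) ξ
  have D1114 := theta1114_sub hτ (e₁ := c₁) (e₂ := c₂) (e₃ := -c₃) (e₄ := -c₄)
    (by linear_combination s12 + s34) (by rwa [s12]) ξ
  have D1141 := theta1114_sub hτ (e₁ := c₁) (e₂ := c₂) (e₃ := -c₄) (e₄ := -c₃)
    (by linear_combination s12 + s34) (by rwa [s12]) ξ
  have D1411 := theta1114_sub hτ (e₁ := -c₃) (e₂ := -c₄) (e₃ := c₁) (e₄ := c₂)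
    (by linear_combination s12 + s34) (by rwa [s34]) ξ
  have D4111 := theta1114_sub hτ (e₁ := -c₃) (e₂ := -c₄) (e₃ := c₂) (e₄ := c₁)
    (by linear_combination s12 + s34) (by rwa [s34]) ξ
  rw [s12, s13, s14] at D4444 D1111 D4411
  rw [s34, s31, s32] at D1144
  rw [s13, s12, s14] at D4141
  rw [s24, s12', s23] at D1414
  rw [s14, s12, s13] at D4114
  rw [s23, s12', s24] at D1441
  have e : ∀ c : ℂ, ξ + -c = ξ - c := fun c => (sub_eq_add_neg _ _).symm
  simp only [sub_neg_eq_add, e, theta1_neg, theta4_neg, theta1_two_mul hτ ξ,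
    theta1_eq_thetaRatio_mul h₁, theta1_eq_thetaRatio_mul h₂, theta1_eq_thetaRatio_mul h₃,
    theta1_eq_thetaRatio_mul h₄, theta1_eq_thetaRatio_mul ha, theta1_eq_thetaRatio_mul hb,
    theta1_eq_thetaRatio_mul hγ, theta1_eq_thetaRatio_mul hξ]
    at D4444 D1111 D4411 D1144 D4141 D1414 D4114 D1441 D4441 D4414 D4144 D1444 D1114 D1141
      D1411 D4111 hω
  generalize thetaRatio τ ξ = u at *
  generalize thetaRatio τ c₁ = f₁ at *
  generalize thetaRatio τ c₂ = f₂ at *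
  generalize thetaRatio τ c₃ = f₃ at *
  generalize thetaRatio τ c₄ = f₄ at *
  generalize thetaRatio τ (2 * γ) = g at *
  generalize thetaRatio τ (2 * a) = A at *
  generalize thetaRatio τ (2 * b) = B at *
  -- The identities of odd type carry an extra factor `θ₄(ξ)`.
  refine mul_left_cancel₀ hξ ?_
  simp only [leg, ellPoly]
  linear_combination (theta4 τ 0 * theta4 τ ξ) * (p * m * u ^ 2 * D4444 + p * m * D4411
      + p * u * (D4114 + D4141) + m * u * (D1414 + D1441) + u ^ 2 * D1144 + D1111)
    - p * m * u * (D4441 + D4414) - p * u ^ 2 * D4144 - p * D4111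
    - m * u ^ 2 * D1444 - m * D1411 - u * (D1114 + D1141)
    + theta4 τ ξ ^ 2 * thetaDup τ ξ * u * (p * m * u ^ 2 * g * A * B - p * m * g
      + p * u * (B - A) + m * u * (A - B) + u ^ 2 * g - g * A * B) * hω


end Legs

/-! ### Elimination of the nearest neighbours, and passage to branch points. -/

section Reduction

variable {τ : ℂ}

lemma continuousAt_thetaRatio (hτ : 0 < τ.im) {z : ℂ} (hz : theta4 τ z ≠ 0) :
    ContinuousAt (thetaRatio τ) z :=
  (differentiable_theta1 hτ).continuous.continuousAt.div
    (differentiable_theta4 hτ).continuous.continuousAt hz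

/-- On a quad equation, the leg of the variable `z` in terms of the legs of `x` and `y`. -/
lemma quadLead_mul_leg (hτ : 0 < τ.im) {a b ξ : ℂ} (hξ : theta4 τ ξ ≠ 0) (ha : theta4 τ a ≠ 0)
    (hb : theta4 τ b ≠ 0) (hab : theta4 τ (a - b) ≠ 0) (hH : thetaDup τ ξ ≠ 0) {x y z : ℂ}
    (h : quad (thetaRatio τ a) (thetaRatio τ b) (thetaRatio τ (a - b)) (thetaRatio τ ξ) x y z = 0) :
    theta4 τ ξ * (theta4 τ a * theta4 τ b * theta4 τ (a - b)) * quadLead (thetaRatio τ a)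
        (thetaRatio τ b) (thetaRatio τ (a - b)) (thetaRatio τ ξ) x y * leg τ (ξ + (a - b)) z
      = theta4 τ 0 * theta4 τ (a - b) * theta1 τ (a - b) * (leg τ (ξ + a) x * leg τ (ξ - b) y) ∧
    theta4 τ ξ * (theta4 τ a * theta4 τ b * theta4 τ (a - b)) * quadLead (thetaRatio τ a)
        (thetaRatio τ b) (thetaRatio τ (a - b)) (thetaRatio τ ξ) x y * leg τ (ξ - (a - b)) z
      = theta4 τ 0 * theta4 τ (a - b) * theta1 τ (a - b)
        * (leg τ (ξ - a) x * leg τ (ξ + b) y) := by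
  have h0 := three_leg hτ hξ ha hb hab x y z
  -- The difference from the instance at `z` isolates the coefficient of `z`. With the Wronskian
  -- this is a linear system for the two long legs; both carry the factor `thetaDup`, which cancels.
  have h1 := three_leg hτ hξ ha hb hab x y (z + 1)
  have hw := leg_wronskian hτ (a - b) ξ
  have hz : quad (thetaRatio τ a) (thetaRatio τ b) (thetaRatio τ (a - b)) (thetaRatio τ ξ) x y
      (z + 1) = quadLead (thetaRatio τ a) (thetaRatio τ b) (thetaRatio τ (a - b))
        (thetaRatio τ ξ) x y := by
    unfold quad at h ⊢; linear_combination h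
  rw [h] at h0
  rw [hz] at h1
  have hp : ∀ q, leg τ q (z + 1) = leg τ q z + theta4 τ q := fun q => by unfold leg; ring
  rw [hp, hp] at h1
  constructor
  · refine mul_left_cancel₀ hH ?_
    simp only [leg] at *
    linear_combination (theta4 τ ξ * (theta4 τ (ξ + (a - b)) * z - theta1 τ (ξ + (a - b))))
      * (h1 - h0) - theta4 τ ξ * theta4 τ (ξ + (a - b)) * h0
      - ((theta4 τ (ξ + a) * x - theta1 τ (ξ + a))
      * (theta4 τ (ξ - b) * y - theta1 τ (ξ - b))) * hw
  · refine mul_left_cancel₀ hH ?_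
    simp only [leg] at *
    linear_combination (theta4 τ ξ * (theta4 τ (ξ - (a - b)) * z - theta1 τ (ξ - (a - b))))
      * (h1 - h0) - theta4 τ ξ * theta4 τ (ξ - (a - b)) * h0
      - ((theta4 τ (ξ - a) * x - theta1 τ (ξ - a))
      * (theta4 τ (ξ + b) * y - theta1 τ (ξ + b))) * hw

/-- Q4 on the four quads around a vertex with two equal diagonal neighbours eliminates the four
nearest neighbours. -/
lemma ellRel_mul_of_quad (hτ : 0 < τ.im) {γ a b A₁ A₃ B₂ B₄ ξ : ℂ}
    (h₁₂ : A₁ - B₂ = γ + a - b) (h₃₄ : A₃ - B₄ = γ - a + b)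
    (h₃₂ : A₃ - B₂ = γ - a - b) (h₁₄ : A₁ - B₄ = γ + a + b)
    (hc : CoeffFinite τ γ a b) (hA₁ : theta4 τ A₁ ≠ 0) (hA₃ : theta4 τ A₃ ≠ 0)
    (hB₂ : theta4 τ B₂ ≠ 0) (hB₄ : theta4 τ B₄ ≠ 0) (hξ : theta4 τ ξ ≠ 0) (hH : thetaDup τ ξ ≠ 0)
    {x₁ x₂ x₃ x₄ m p : ℂ}
    (hp : quad (thetaRatio τ A₁) (thetaRatio τ B₂) (thetaRatio τ (γ + a - b)) (thetaRatio τ ξ)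
      x₁ x₂ p = 0)
    (hm : quad (thetaRatio τ A₃) (thetaRatio τ B₄) (thetaRatio τ (γ - a + b)) (thetaRatio τ ξ)
      x₃ x₄ m = 0) :
    (theta4 τ ξ ^ 3 * (theta4 τ A₁ * theta4 τ B₂ * theta4 τ (γ + a - b))
      * (theta4 τ A₃ * theta4 τ B₄ * theta4 τ (γ - a + b))
      * (theta4 τ (γ + a - b) * theta4 τ (γ - a + b) * theta4 τ (γ - a - b)
        * theta4 τ (γ + a + b)))
      * quadLead (thetaRatio τ A₁) (thetaRatio τ B₂) (thetaRatio τ (γ + a - b)) (thetaRatio τ ξ)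
        x₁ x₂
      * quadLead (thetaRatio τ A₃) (thetaRatio τ B₄) (thetaRatio τ (γ - a + b)) (thetaRatio τ ξ)
        x₃ x₄
      * ellRel τ γ a b m (thetaRatio τ ξ) p
    = (theta4 τ 0 * (theta4 τ 0 * theta4 τ (γ + a - b) * theta1 τ (γ + a - b))
      * (theta4 τ 0 * theta4 τ (γ - a + b) * theta1 τ (γ - a + b)))
      * (theta4 τ A₃ * theta4 τ B₂ * theta4 τ (γ - a - b)
        * quad (thetaRatio τ A₃) (thetaRatio τ B₂) (thetaRatio τ (γ - a - b)) (thetaRatio τ ξ)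
          x₃ x₂ (thetaRatio τ ξ)
        * (leg τ (ξ + A₁) x₁ * leg τ (ξ - B₄) x₄ * leg τ (ξ - (γ + a + b)) (thetaRatio τ ξ))
      + theta4 τ A₁ * theta4 τ B₄ * theta4 τ (γ + a + b)
        * quad (thetaRatio τ A₁) (thetaRatio τ B₄) (thetaRatio τ (γ + a + b)) (thetaRatio τ ξ)
          x₁ x₄ (thetaRatio τ ξ)
        * (leg τ (ξ - A₃) x₃ * leg τ (ξ + B₂) x₂
          * leg τ (ξ + (γ - a - b)) (thetaRatio τ ξ))) := by
  have hT := toda_eq_ellRel hτ hξ hc m p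
  obtain ⟨-, -, -, h₁, h₂, h₃, h₄⟩ := hc
  rw [← h₁₂] at hp h₁
  rw [← h₃₄] at hm h₂
  rw [← h₃₂] at h₃
  rw [← h₁₄] at h₄
  obtain ⟨hp₁, hp₂⟩ := quadLead_mul_leg hτ hξ hA₁ hB₂ h₁ hH hp
  obtain ⟨hm₁, hm₂⟩ := quadLead_mul_leg hτ hξ hA₃ hB₄ h₂ hH hm
  have l₃ := three_leg hτ hξ hA₃ hB₂ h₃ x₃ x₂ (thetaRatio τ ξ)
  have l₄ := three_leg hτ hξ hA₁ hB₄ h₄ x₁ x₄ (thetaRatio τ ξ)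
  rw [h₁₂] at hp₁ hp₂
  rw [h₃₄] at hm₁ hm₂
  rw [h₃₂] at l₃
  rw [h₁₄] at l₄
  refine mul_left_cancel₀ hH ?_
  generalize leg τ (ξ + (γ + a - b)) p = P₁ at *
  generalize leg τ (ξ - (γ + a - b)) p = M₁ at *
  generalize leg τ (ξ + (γ - a + b)) m = P₂ at *
  generalize leg τ (ξ - (γ - a + b)) m = M₂ at *
  generalize leg τ (ξ + (γ - a - b)) (thetaRatio τ ξ) = P₃ at *
  generalize leg τ (ξ - (γ - a - b)) (thetaRatio τ ξ) = M₃ at *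
  generalize leg τ (ξ + (γ + a + b)) (thetaRatio τ ξ) = P₄ at *
  generalize leg τ (ξ - (γ + a + b)) (thetaRatio τ ξ) = M₄ at *
  generalize leg τ (ξ + A₁) x₁ = p₁ at *
  generalize leg τ (ξ - A₁) x₁ = n₁ at *
  generalize leg τ (ξ + B₂) x₂ = p₂ at *
  generalize leg τ (ξ - B₂) x₂ = n₂ at *
  generalize leg τ (ξ + A₃) x₃ = p₃ at *
  generalize leg τ (ξ - A₃) x₃ = n₃ at *
  generalize leg τ (ξ + B₄) x₄ = p₄ at *
  generalize leg τ (ξ - B₄) x₄ = n₄ at *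
  generalize quad (thetaRatio τ A₃) _ _ _ _ _ _ = Q₃ at *
  generalize quad (thetaRatio τ A₁) (thetaRatio τ B₄) _ _ _ _ _ = Q₄ at *
  generalize quadLead (thetaRatio τ A₁) _ _ _ _ _ = q₁ at *
  generalize quadLead (thetaRatio τ A₃) _ _ _ _ _ = q₂ at *
  generalize ellRel _ _ _ _ _ _ _ = E at *
  generalize theta4 τ A₁ * theta4 τ B₂ * theta4 τ (γ + a - b) = κ₁ at *
  generalize theta4 τ A₃ * theta4 τ B₄ * theta4 τ (γ - a + b) = κ₂ at *
  generalize theta4 τ 0 * theta4 τ (γ + a - b) * theta1 τ (γ + a - b) = g₁ at *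
  generalize theta4 τ 0 * theta4 τ (γ - a + b) * theta1 τ (γ - a + b) = g₂ at *
  -- The two solved quads trade the long legs of `p` and `m` for short legs, which pair up into the
  -- three-leg forms of the other two quads. Their polynomials remain as residuals.
  linear_combination (theta4 τ ξ ^ 2 * κ₁ * κ₂ * q₁ * q₂) * hT
    - theta4 τ 0 * M₃ * M₄ * (theta4 τ ξ * κ₂ * q₂ * P₂ * hp₁ + g₁ * p₁ * n₂ * hm₁)
    + theta4 τ 0 * P₃ * P₄ * (theta4 τ ξ * κ₂ * q₂ * M₂ * hp₂ + g₁ * n₁ * p₂ * hm₂)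
    - theta4 τ 0 * g₁ * g₂ * (p₁ * n₄ * M₄ * l₃ + n₃ * p₂ * P₃ * l₄)

lemma continuousAt_ellRel {γ a b z : ℂ} {m u p : ℂ → ℂ} (hm : ContinuousAt m z)
    (hu : ContinuousAt u z) (hp : ContinuousAt p z) :
    ContinuousAt (fun w => ellRel τ γ a b (m w) (u w) (p w)) z := by
  unfold ellRel ellPoly
  fun_prop

/-- A zero of `thetaDup` at `ξ` is bypassed by moving the centre to a nearby `w` with `x₁, …, x₄`
fixed. The values `p` and `m` are redefined by the first two quads, continuously because the leading
coefficients do not vanish. The other two quads fail at `w`, which is why the elimination identity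
keeps their residuals; these vanish as `w` tends to `ξ`. -/
lemma ellRel_of_quad (hτ : 0 < τ.im) {γ a b A₁ A₃ B₂ B₄ ξ : ℂ}
    (h₁₂ : A₁ - B₂ = γ + a - b) (h₃₄ : A₃ - B₄ = γ - a + b)
    (h₃₂ : A₃ - B₂ = γ - a - b) (h₁₄ : A₁ - B₄ = γ + a + b)
    (hc : CoeffFinite τ γ a b) (hA₁ : theta4 τ A₁ ≠ 0) (hA₃ : theta4 τ A₃ ≠ 0)
    (hB₂ : theta4 τ B₂ ≠ 0) (hB₄ : theta4 τ B₄ ≠ 0) (hξ : theta4 τ ξ ≠ 0)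
    {x₁ x₂ x₃ x₄ m p : ℂ}
    (hq₁ : quadLead (thetaRatio τ A₁) (thetaRatio τ B₂) (thetaRatio τ (γ + a - b))
      (thetaRatio τ ξ) x₁ x₂ ≠ 0)
    (hq₂ : quadLead (thetaRatio τ A₃) (thetaRatio τ B₄) (thetaRatio τ (γ - a + b))
      (thetaRatio τ ξ) x₃ x₄ ≠ 0)
    (hp : quad (thetaRatio τ A₁) (thetaRatio τ B₂) (thetaRatio τ (γ + a - b)) (thetaRatio τ ξ)
      x₁ x₂ p = 0)
    (hm : quad (thetaRatio τ A₃) (thetaRatio τ B₄) (thetaRatio τ (γ - a + b)) (thetaRatio τ ξ)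
      x₃ x₄ m = 0)
    (h₃ : quad (thetaRatio τ A₃) (thetaRatio τ B₂) (thetaRatio τ (γ - a - b)) (thetaRatio τ ξ)
      x₃ x₂ (thetaRatio τ ξ) = 0)
    (h₄ : quad (thetaRatio τ A₁) (thetaRatio τ B₄) (thetaRatio τ (γ + a + b)) (thetaRatio τ ξ)
      x₁ x₄ (thetaRatio τ ξ) = 0) :
    ellRel τ γ a b m (thetaRatio τ ξ) p = 0 := by
  have c1 := (differentiable_theta1 hτ).continuous
  have c4 := (differentiable_theta4 hτ).continuous
  have cr := continuousAt_thetaRatio hτ hξ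
  set q₁ : ℂ → ℂ := fun w => quadLead (thetaRatio τ A₁) (thetaRatio τ B₂)
    (thetaRatio τ (γ + a - b)) (thetaRatio τ w) x₁ x₂ with hq₁_def
  set q₂ : ℂ → ℂ := fun w => quadLead (thetaRatio τ A₃) (thetaRatio τ B₄)
    (thetaRatio τ (γ - a + b)) (thetaRatio τ w) x₃ x₄ with hq₂_def
  set r₁ : ℂ → ℂ := fun w => quadConst (thetaRatio τ A₁) (thetaRatio τ B₂)
    (thetaRatio τ (γ + a - b)) (thetaRatio τ w) x₁ x₂ with hr₁_def
  set r₂ : ℂ → ℂ := fun w => quadConst (thetaRatio τ A₃) (thetaRatio τ B₄)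
    (thetaRatio τ (γ - a + b)) (thetaRatio τ w) x₃ x₄ with hr₂_def
  have cq₁ : ContinuousAt q₁ ξ := by simp only [hq₁_def, quadLead]; fun_prop
  have cq₂ : ContinuousAt q₂ ξ := by simp only [hq₂_def, quadLead]; fun_prop
  have cr₁ : ContinuousAt r₁ ξ := by simp only [hr₁_def, quadConst]; fun_prop
  have cr₂ : ContinuousAt r₂ ξ := by simp only [hr₂_def, quadConst]; fun_prop
  have cE := continuousAt_ellRel (τ := τ) (γ := γ) (a := a) (b := b)
    (cr₂.neg.div cq₂ hq₂) cr (cr₁.neg.div cq₁ hq₁)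
  have key := eq_of_eventuallyEq_nhdsNE (z := ξ) (f := fun w =>
    (theta4 τ w ^ 3 * (theta4 τ A₁ * theta4 τ B₂ * theta4 τ (γ + a - b))
      * (theta4 τ A₃ * theta4 τ B₄ * theta4 τ (γ - a + b))
      * (theta4 τ (γ + a - b) * theta4 τ (γ - a + b) * theta4 τ (γ - a - b)
        * theta4 τ (γ + a + b))) * q₁ w * q₂ w
      * ellRel τ γ a b (-r₂ w / q₂ w) (thetaRatio τ w) (-r₁ w / q₁ w))
    (g := fun w =>
      (theta4 τ 0 * (theta4 τ 0 * theta4 τ (γ + a - b) * theta1 τ (γ + a - b))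
      * (theta4 τ 0 * theta4 τ (γ - a + b) * theta1 τ (γ - a + b)))
      * (theta4 τ A₃ * theta4 τ B₂ * theta4 τ (γ - a - b)
        * quad (thetaRatio τ A₃) (thetaRatio τ B₂) (thetaRatio τ (γ - a - b)) (thetaRatio τ w)
          x₃ x₂ (thetaRatio τ w)
        * (leg τ (w + A₁) x₁ * leg τ (w - B₄) x₄ * leg τ (w - (γ + a + b)) (thetaRatio τ w))
      + theta4 τ A₁ * theta4 τ B₄ * theta4 τ (γ + a + b)
        * quad (thetaRatio τ A₁) (thetaRatio τ B₄) (thetaRatio τ (γ + a + b)) (thetaRatio τ w)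
          x₁ x₄ (thetaRatio τ w)
        * (leg τ (w - A₃) x₃ * leg τ (w + B₂) x₂
          * leg τ (w + (γ - a - b)) (thetaRatio τ w))))
    (by exact (ContinuousAt.mul (by fun_prop) cq₁).mul cq₂ |>.mul cE)
    (by unfold quad quadLead quadConst leg; fun_prop)
    (by
      filter_upwards [eventually_thetaDup_ne_zero hτ ξ,
        (c4.continuousAt.eventually_ne hξ).filter_mono nhdsWithin_le_nhds,
        (cq₁.eventually_ne hq₁).filter_mono nhdsWithin_le_nhds,
        (cq₂.eventually_ne hq₂).filter_mono nhdsWithin_le_nhds] with w hw hw' k₁ k₂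
      refine ellRel_mul_of_quad hτ h₁₂ h₃₄ h₃₂ h₁₄ hc hA₁ hA₃ hB₂ hB₄ hw' hw ?_ ?_
      · change q₁ w * (-r₁ w / q₁ w) + r₁ w = 0
        field_simp; ring
      · change q₂ w * (-r₂ w / q₂ w) + r₂ w = 0
        field_simp; ring)
  have ep : -r₁ ξ / q₁ ξ = p := by
    rw [div_eq_iff hq₁]
    change q₁ ξ * p + r₁ ξ = 0 at hp
    linear_combination -hp
  have em : -r₂ ξ / q₂ ξ = m := by
    rw [div_eq_iff hq₂]
    change q₂ ξ * m + r₂ ξ = 0 at hm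
    linear_combination -hm
  simp only [ep, em, h₃, h₄, mul_zero, zero_mul, add_zero] at key
  obtain ⟨-, -, -, k₁, k₂, k₃, k₄⟩ := hc
  have hq₁' : q₁ ξ ≠ 0 := hq₁
  have hq₂' : q₂ ξ ≠ 0 := hq₂
  simpa [hξ, hA₁, hA₃, hB₂, hB₄, k₁, k₂, k₃, k₄, hq₁', hq₂'] using key

/-- The trivial solution of the elliptic difference equation. -/
lemma ellRel_thetaRatio (hτ : 0 < τ.im) {γ a b ξ : ℂ} (hc : CoeffFinite τ γ a b)
    (hξ : theta4 τ ξ ≠ 0) (hm : theta4 τ (ξ - (γ - a + b)) ≠ 0)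
    (hp : theta4 τ (ξ + (γ + a - b)) ≠ 0) :
    ellRel τ γ a b (thetaRatio τ (ξ - (γ - a + b))) (thetaRatio τ ξ)
      (thetaRatio τ (ξ + (γ + a - b))) = 0 := by
  have c4 := (differentiable_theta4 hτ).continuous
  refine eq_of_eventuallyEq_nhdsNE (z := ξ)
    (f := fun w => ellRel τ γ a b (thetaRatio τ (w - (γ - a + b))) (thetaRatio τ w)
      (thetaRatio τ (w + (γ + a - b)))) (g := fun _ => 0)
    (continuousAt_ellRel ?_ (continuousAt_thetaRatio hτ hξ) ?_) continuousAt_const ?_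
  · exact ContinuousAt.comp' (f := fun w => w - (γ - a + b)) (continuousAt_thetaRatio hτ hm)
      (by fun_prop)
  · exact ContinuousAt.comp' (f := fun w => w + (γ + a - b)) (continuousAt_thetaRatio hτ hp)
      (by fun_prop)
  · have n1 : ∀ᶠ w in 𝓝 ξ, theta4 τ (w - (γ - a + b)) ≠ 0 :=
      ContinuousAt.eventually_ne (g := fun w => theta4 τ (w - (γ - a + b))) (by fun_prop) hm
    have n2 : ∀ᶠ w in 𝓝 ξ, theta4 τ (w + (γ + a - b)) ≠ 0 :=
      ContinuousAt.eventually_ne (g := fun w => theta4 τ (w + (γ + a - b))) (by fun_prop) hp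
    filter_upwards [eventually_thetaDup_ne_zero hτ ξ,
      (c4.continuousAt.eventually_ne hξ).filter_mono nhdsWithin_le_nhds,
      n1.filter_mono nhdsWithin_le_nhds, n2.filter_mono nhdsWithin_le_nhds] with w hH hw hw₁ hw₂
    have hT := toda_eq_ellRel hτ hw hc (thetaRatio τ (w - (γ - a + b)))
      (thetaRatio τ (w + (γ + a - b)))
    -- The leg of `p` kills the first product of the five-point relation and the leg of `m` the
    -- second.
    have l : ∀ q, theta4 τ q ≠ 0 → leg τ q (thetaRatio τ q) = 0 := fun q hq => by
      rw [leg, thetaRatio, mul_div_cancel₀ _ hq, sub_self]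
    rw [l _ hw₁, l _ hw₂] at hT
    obtain ⟨-, -, -, k₁, k₂, k₃, k₄⟩ := hc
    simpa [hH, hw, k₁, k₂, k₃, k₄] using hT

/-! ### The five-point relation for arbitrary parameters -/

/-- Each quad expresses a ratio of long legs by short legs, and around the vertex the short legs
cancel. To avoid dividing by them, two opposite quads are solved for their long legs with the
nonzero leading coefficients. -/
lemma toda_of_quad (hτ : 0 < τ.im) {A₁ A₃ B₂ B₄ ξ : ℂ} (hA₁ : theta4 τ A₁ ≠ 0)
    (hA₃ : theta4 τ A₃ ≠ 0) (hB₂ : theta4 τ B₂ ≠ 0) (hB₄ : theta4 τ B₄ ≠ 0)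
    (h₁₂ : theta4 τ (A₁ - B₂) ≠ 0) (h₃₄ : theta4 τ (A₃ - B₄) ≠ 0)
    (h₃₂ : theta4 τ (A₃ - B₂) ≠ 0) (h₁₄ : theta4 τ (A₁ - B₄) ≠ 0)
    (hξ : theta4 τ ξ ≠ 0) (hH : thetaDup τ ξ ≠ 0) {x₁ x₂ x₃ x₄ z₁₂ z₃₄ z₃₂ z₁₄ : ℂ}
    (hq₁ : quadLead (thetaRatio τ A₁) (thetaRatio τ B₂) (thetaRatio τ (A₁ - B₂))
      (thetaRatio τ ξ) x₁ x₂ ≠ 0)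
    (hq₂ : quadLead (thetaRatio τ A₃) (thetaRatio τ B₄) (thetaRatio τ (A₃ - B₄))
      (thetaRatio τ ξ) x₃ x₄ ≠ 0)
    (q₁₂ : quad (thetaRatio τ A₁) (thetaRatio τ B₂) (thetaRatio τ (A₁ - B₂)) (thetaRatio τ ξ)
      x₁ x₂ z₁₂ = 0)
    (q₃₄ : quad (thetaRatio τ A₃) (thetaRatio τ B₄) (thetaRatio τ (A₃ - B₄)) (thetaRatio τ ξ)
      x₃ x₄ z₃₄ = 0)
    (q₃₂ : quad (thetaRatio τ A₃) (thetaRatio τ B₂) (thetaRatio τ (A₃ - B₂)) (thetaRatio τ ξ)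
      x₃ x₂ z₃₂ = 0)
    (q₁₄ : quad (thetaRatio τ A₁) (thetaRatio τ B₄) (thetaRatio τ (A₁ - B₄)) (thetaRatio τ ξ)
      x₁ x₄ z₁₄ = 0) :
    leg τ (ξ + (A₁ - B₂)) z₁₂ * leg τ (ξ + (A₃ - B₄)) z₃₄ * leg τ (ξ - (A₃ - B₂)) z₃₂
        * leg τ (ξ - (A₁ - B₄)) z₁₄
      = leg τ (ξ - (A₁ - B₂)) z₁₂ * leg τ (ξ - (A₃ - B₄)) z₃₄ * leg τ (ξ + (A₃ - B₂)) z₃₂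
        * leg τ (ξ + (A₁ - B₄)) z₁₄ := by
  have l₃ := three_leg hτ hξ hA₃ hB₂ h₃₂ x₃ x₂ z₃₂
  have l₄ := three_leg hτ hξ hA₁ hB₄ h₁₄ x₁ x₄ z₁₄
  obtain ⟨p₁, p₂⟩ := quadLead_mul_leg hτ hξ hA₁ hB₂ h₁₂ hH q₁₂
  obtain ⟨m₁, m₂⟩ := quadLead_mul_leg hτ hξ hA₃ hB₄ h₃₄ hH q₃₄
  rw [q₃₂] at l₃
  rw [q₁₄] at l₄
  set κ₁ := theta4 τ ξ * (theta4 τ A₁ * theta4 τ B₂ * theta4 τ (A₁ - B₂)) * quadLead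
    (thetaRatio τ A₁) (thetaRatio τ B₂) (thetaRatio τ (A₁ - B₂)) (thetaRatio τ ξ) x₁ x₂ with hκ₁
  set κ₂ := theta4 τ ξ * (theta4 τ A₃ * theta4 τ B₄ * theta4 τ (A₃ - B₄)) * quadLead
    (thetaRatio τ A₃) (thetaRatio τ B₄) (thetaRatio τ (A₃ - B₄)) (thetaRatio τ ξ) x₃ x₄ with hκ₂
  have n₁ : κ₁ ≠ 0 := by simp [hκ₁, hξ, hA₁, hB₂, h₁₂, hq₁]
  have n₂ : κ₂ ≠ 0 := by simp [hκ₂, hξ, hA₃, hB₄, h₃₄, hq₂]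
  set g₁ := theta4 τ 0 * theta4 τ (A₁ - B₂) * theta1 τ (A₁ - B₂)
  set g₂ := theta4 τ 0 * theta4 τ (A₃ - B₄) * theta1 τ (A₃ - B₄)
  refine mul_left_cancel₀ (mul_ne_zero n₁ n₂) ?_
  linear_combination leg τ (ξ - (A₃ - B₂)) z₃₂ * leg τ (ξ - (A₁ - B₄)) z₁₄
      * (κ₂ * leg τ (ξ + (A₃ - B₄)) z₃₄ * p₁ + g₁ * leg τ (ξ + A₁) x₁ * leg τ (ξ - B₂) x₂ * m₁)
    - leg τ (ξ + (A₃ - B₂)) z₃₂ * leg τ (ξ + (A₁ - B₄)) z₁₄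
      * (κ₂ * leg τ (ξ - (A₃ - B₄)) z₃₄ * p₂ + g₁ * leg τ (ξ - A₁) x₁ * leg τ (ξ + B₂) x₂ * m₂)
    + g₁ * g₂ * (leg τ (ξ + A₁) x₁ * leg τ (ξ - B₄) x₄ * leg τ (ξ - (A₁ - B₄)) z₁₄ * l₃
      + leg τ (ξ - A₃) x₃ * leg τ (ξ + B₂) x₂ * leg τ (ξ + (A₃ - B₂)) z₃₂ * l₄)

/-- At a branch point the five-point relation holds identically. -/
lemma toda_of_thetaDup_eq_zero (hτ : 0 < τ.im) {A₁ A₃ B₂ B₄ ξ : ℂ} (hH : thetaDup τ ξ = 0)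
    (hξ : theta4 τ ξ ≠ 0)
    (h₁₂ : theta4 τ (ξ - (A₁ - B₂)) ≠ 0) (h₃₄ : theta4 τ (ξ - (A₃ - B₄)) ≠ 0)
    (h₃₂ : theta4 τ (ξ - (A₃ - B₂)) ≠ 0) (h₁₄ : theta4 τ (ξ - (A₁ - B₄)) ≠ 0)
    (z₁₂ z₃₄ z₃₂ z₁₄ : ℂ) :
    leg τ (ξ + (A₁ - B₂)) z₁₂ * leg τ (ξ + (A₃ - B₄)) z₃₄ * leg τ (ξ - (A₃ - B₂)) z₃₂
        * leg τ (ξ - (A₁ - B₄)) z₁₄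
      = leg τ (ξ - (A₁ - B₂)) z₁₂ * leg τ (ξ - (A₃ - B₄)) z₃₄ * leg τ (ξ + (A₃ - B₂)) z₃₂
        * leg τ (ξ + (A₁ - B₄)) z₁₄ := by
  -- The Wronskian vanishes here, so opposite legs are proportional with a ratio independent of `z`.
  -- What remains is a relation among `θ₄` alone, given by `theta4444_sub` with `θ₁(2ξ) = 0`.
  have hl : ∀ c z, theta4 τ (ξ - c) ≠ 0 →
      leg τ (ξ + c) z = theta4 τ (ξ + c) / theta4 τ (ξ - c) * leg τ (ξ - c) z := by
    intro c z hc
    have h := leg_wronskian hτ c ξ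
    rw [hH, zero_mul, neg_zero, mul_eq_zero, or_iff_right hξ] at h
    rw [div_mul_eq_mul_div, eq_div_iff hc]
    unfold leg
    linear_combination h
  have h := theta4444_sub hτ (e₁ := A₁ - B₂) (e₂ := A₃ - B₄) (e₃ := -(A₃ - B₂))
    (e₄ := -(A₁ - B₄)) (by ring) ξ
  rw [theta1_two_mul hτ, hH] at h
  simp only [sub_neg_eq_add, ← sub_eq_add_neg, zero_mul, neg_zero, sub_eq_zero] at h
  rw [hl _ _ h₁₂, hl _ _ h₃₄, hl _ _ h₃₂, hl _ _ h₁₄]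
  field_simp
  linear_combination leg τ (ξ - (A₁ - B₂)) z₁₂ * leg τ (ξ - (A₃ - B₄)) z₃₄
    * leg τ (ξ - (A₃ - B₂)) z₃₂ * leg τ (ξ - (A₁ - B₄)) z₁₄ * h

end Reduction

/-! ### Every complex number is a value of `√k sn`. -/

section Surjectivity

variable {τ : ℂ}

lemma linearIndependent_one_of_im_pos (hτ : 0 < τ.im) : LinearIndependent ℝ ![1, τ] := by
  rw [LinearIndependent.pair_iff]
  intro x y h
  have hi := congrArg Complex.im h
  simp [hτ.ne'] at hi
  subst hi
  simpa using h

/-- An entire function that is doubly periodic is constant. -/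
lemma eq_of_doubly_periodic (hτ : 0 < τ.im) {f : ℂ → ℂ} (hf : Differentiable ℂ f)
    (h1 : Function.Periodic f 1) (h2 : Function.Periodic f τ) (z w : ℂ) : f z = f w := by
  let L : PeriodPair := ⟨1, τ, linearIndependent_one_of_im_pos hτ⟩
  refine hf.apply_eq_apply_of_bounded
    (IsZLattice.isCompact_range_of_periodic L.lattice f hf.continuous fun x l hl => ?_).isBounded z w
  obtain ⟨m, n, rfl⟩ := PeriodPair.mem_lattice.1 hl
  rw [← add_assoc]
  exact ((h2.int_mul n) _).trans ((h1.int_mul m) _)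

/-- A nonvanishing entire function with period `1` cannot have a nontrivial multiplier
`exp (c z + d)` for the period `τ`. -/
lemma exists_eq_zero_of_quasiperiodic (hτ : 0 < τ.im) {g : ℂ → ℂ} (hg : Differentiable ℂ g)
    {c d : ℂ} (hc : c ≠ 0) (h1 : ∀ z, g (z + 1) = g z)
    (h2 : ∀ z, g (z + τ) = exp (c * z + d) * g z) : ∃ z, g z = 0 := by
  by_contra! h0
  have hg' : Differentiable ℂ (deriv g) := hg.deriv
  -- The logarithmic derivative is entire, has period `1` and gains `c` under `τ`. Its derivative is
  -- doubly periodic, hence constant; period `1` makes the slope zero, so `c = 0`.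
  set L : ℂ → ℂ := fun z => deriv g z / g z with hL
  have dL : Differentiable ℂ L := hg'.div hg h0
  have L1 : ∀ z, L (z + 1) = L z := fun z => by
    have : deriv g (z + 1) = deriv g z := by
      rw [← deriv_comp_add_const]; simp only [h1]
    simp only [hL, this, h1]
  have L2 : ∀ z, L (z + τ) = L z + c := fun z => by
    have hd : deriv g (z + τ) = exp (c * z + d) * c * g z + exp (c * z + d) * deriv g z := by
      rw [← deriv_comp_add_const]
      simp only [h2]
      have he : HasDerivAt (fun z => exp (c * z + d)) (exp (c * z + d) * c) z := by
        simpa using (((hasDerivAt_id z).const_mul c).add_const d).cexp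
      exact (he.mul (hg z).hasDerivAt).deriv
    simp only [hL, hd, h2]
    have := exp_ne_zero (c * z + d)
    have := h0 z
    field_simp
    ring
  have D1 : Function.Periodic (deriv L) 1 := fun z => by
    rw [← deriv_comp_add_const]; simp only [L1]
  have D2 : Function.Periodic (deriv L) τ := fun z => by
    rw [← deriv_comp_add_const]; simp only [L2, deriv_add_const]
  have hconst : ∀ z, deriv L z = deriv L 0 := fun z =>
    eq_of_doubly_periodic hτ dL.deriv D1 D2 z 0
  have hlin : ∀ z, L z = deriv L 0 * z + L 0 := fun z => by
    have := is_const_of_deriv_eq_zero (f := fun z => L z - deriv L 0 * z) (by fun_prop)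
      (fun w => by
        rw [deriv_fun_sub (dL w) (by fun_prop), hconst w]
        simp) z 0
    simp only [mul_zero, sub_zero] at this
    linear_combination this
  have e1 := L1 0
  have e2 := L2 0
  rw [zero_add, hlin] at e1 e2
  have : deriv L 0 = 0 := by linear_combination e1
  rw [this] at e2
  exact hc (by linear_combination -e2)

/-- A zero of `θ₁² - v² θ₄²` is needed. Squares are used because `θ₁` changes sign under the period
`1` and `θ₄` does not; the resulting ambiguity `±v` is removed by oddness. -/
lemma exists_thetaRatio_eq (hτ : 0 < τ.im) (v : ℂ) :
    ∃ z, theta4 τ z ≠ 0 ∧ thetaRatio τ z = v := by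
  have d1 := differentiable_theta1 hτ
  have d4 := differentiable_theta4 hτ
  obtain ⟨z, hz⟩ := exists_eq_zero_of_quasiperiodic hτ
    (g := fun z => theta1 τ z ^ 2 - v ^ 2 * theta4 τ z ^ 2) (c := -(4 * Real.pi * I))
    (d := -(2 * Real.pi * I * τ)) (by fun_prop) (by simp [Real.pi_ne_zero])
    (fun z => by rw [theta1_add_one, theta4_add_one]; ring)
    (fun z => by
      have he : exp (-(4 * Real.pi * I) * z + -(2 * Real.pi * I * τ))
          = exp (-(Real.pi * I * τ) - 2 * Real.pi * I * z) ^ 2 := by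
        rw [sq, ← exp_add]; congr 1; ring
      rw [theta1_add_tau, theta4_add_tau, he]; ring)
  -- A common zero `z` of `θ₁` and `θ₄` would give `θ₄(z - w) θ₄(z + w) = 0` for all `w`.
  have h4 : theta4 τ z ≠ 0 := by
    intro h4
    have h1 : theta1 τ z = 0 := by simpa [h4] using hz
    obtain ⟨w, hw, hw'⟩ := ((eventually_ne_zero_of_differentiable
      (f := fun c => theta4 τ (z - c)) (by fun_prop) (by
        obtain ⟨w, hw⟩ := (eventually_theta4_ne_zero hτ 0).exists
        exact ⟨z - w, by simpa using hw⟩) 0).and (eventually_ne_zero_of_differentiable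
      (f := fun c => theta4 τ (z + c)) (by fun_prop) (by
        obtain ⟨w, hw⟩ := (eventually_theta4_ne_zero hτ 0).exists
        exact ⟨w - z, by simpa using hw⟩) 0)).exists
    have h := theta4_mul_expand hτ w (-w) z
    rw [h4, h1, sub_neg_eq_add, add_neg_cancel] at h
    simp [theta4_zero_ne_zero hτ, hw, hw'] at h
  have hz' : theta1 τ z ^ 2 = (v * theta4 τ z) ^ 2 := by linear_combination hz
  rcases sq_eq_sq_iff_eq_or_eq_neg.1 hz' with h | h
  · exact ⟨z, h4, by rw [thetaRatio, h, mul_div_cancel_right₀ _ h4]⟩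
  · refine ⟨-z, by rwa [theta4_neg], ?_⟩
    rw [thetaRatio_neg, thetaRatio, h, neg_div, mul_div_cancel_right₀ _ h4, neg_neg]

end Surjectivity

/-! ### From `sn`, modulus and `Θ` to normalised theta quotients. -/

section Translation

variable {τ : ℂ}

/-- The argument `u` measured in units of `2 K`. -/
def scaled (τ u : ℂ) : ℂ := u / (2 * quarterPeriod τ)

lemma scaled_add (x y : ℂ) : scaled τ (x + y) = scaled τ x + scaled τ y := add_div _ _ _

lemma scaled_sub (x y : ℂ) : scaled τ (x - y) = scaled τ x - scaled τ y := sub_div _ _ _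

lemma scaled_two_mul (x : ℂ) : scaled τ (2 * x) = 2 * scaled τ x := mul_div_assoc _ _ _

/-- The factor `1 / √k = θ₃(0) / θ₂(0)` between `sn` and `θ₁ / θ₄`. -/
def snScale (τ : ℂ) : ℂ := theta3 τ 0 / theta2 τ 0

lemma snScale_ne_zero (hτ : 0 < τ.im) : snScale τ ≠ 0 :=
  div_ne_zero (theta3_zero_ne_zero hτ) (theta2_zero_ne_zero hτ)

lemma modulus_mul_snScale_sq (hτ : 0 < τ.im) : modulus τ * snScale τ ^ 2 = 1 := by
  have := theta3_zero_ne_zero hτ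
  have := theta2_zero_ne_zero hτ
  unfold modulus snScale
  field_simp

lemma sn_eq (u : ℂ) : sn τ u = snScale τ * thetaRatio τ (scaled τ u) := rfl

lemma snFinite_iff (u : ℂ) : SnFinite τ u ↔ theta4 τ (scaled τ u) ≠ 0 := Iff.rfl

/-- All monomials have even degree in the lattice variables. The sign `ε = s * snScale τ` records
which square root of `k` was chosen. -/
lemma quad_mul_sign {ε : ℂ} (hε : ε ^ 2 = 1) (A B C w x y z : ℂ) :
    quad A B C (ε * w) (ε * x) (ε * y) (ε * z) = quad A B C w x y z := by
  unfold quad quadLead quadConst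
  linear_combination (A * (w * x + y * z) - B * (w * y + x * z) - C * (x * y + w * z)
    + A * B * C * w * x * y * z * (ε ^ 2 + 1)) * hε

lemma Q4_eq (hτ : 0 < τ.im) {ε : ℂ} (hε : ε ^ 2 = 1) (a b w x y z : ℂ) :
    Q4 τ a b w x y z = snScale τ * quad (thetaRatio τ (scaled τ a)) (thetaRatio τ (scaled τ b))
      (thetaRatio τ (scaled τ a - scaled τ b)) (ε * w) (ε * x) (ε * y) (ε * z) := by
  rw [quad_mul_sign hε, Q4, sn_eq, sn_eq, sn_eq, ← scaled_sub]
  unfold quad quadLead quadConst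
  linear_combination (snScale τ * thetaRatio τ (scaled τ a) * thetaRatio τ (scaled τ b)
    * thetaRatio τ (scaled τ (a - b)) * (1 + w * x * y * z)) * modulus_mul_snScale_sq hτ

lemma Q4_eq_zero_iff (hτ : 0 < τ.im) {ε : ℂ} (hε : ε ^ 2 = 1) (a b w x y z : ℂ) :
    Q4 τ a b w x y z = 0 ↔ quad (thetaRatio τ (scaled τ a)) (thetaRatio τ (scaled τ b))
      (thetaRatio τ (scaled τ a - scaled τ b)) (ε * w) (ε * x) (ε * y) (ε * z) = 0 := by
  rw [Q4_eq hτ hε, mul_eq_zero, or_iff_right (snScale_ne_zero hτ)]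

/-- With zero leading coefficient, `z + 1` would be a solution along with `z`. -/
lemma quadLead_ne_zero_of_existsUnique {ε A B C w x y : ℂ}
    (h : ∃! z : ℂ, quad A B C w x y (ε * z) = 0) : quadLead A B C w x y ≠ 0 := by
  obtain ⟨z, hz, huniq⟩ := h
  intro h0
  have := huniq (z + 1) (by simp only [quad, h0, zero_mul] at hz ⊢; exact hz)
  simp at this

/-- The quotient of `Θ` in `legF` supplies precisely the factors `θ₄` that clear the poles of the
two legs. -/
lemma legF_eq (hτ : 0 < τ.im) {ξ ζ γ : ℂ} (h : LegDefined τ ξ ζ γ) :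
    leg τ (scaled τ ξ - scaled τ γ) (thetaRatio τ (scaled τ ζ)) ≠ 0 ∧
    legF τ ξ ζ γ = leg τ (scaled τ ξ + scaled τ γ) (thetaRatio τ (scaled τ ζ))
      / leg τ (scaled τ ξ - scaled τ γ) (thetaRatio τ (scaled τ ζ)) := by
  obtain ⟨-, hp, hm, hne⟩ := h
  rw [snFinite_iff, scaled_add] at hp
  rw [snFinite_iff, scaled_sub] at hm
  rw [sn_eq, sn_eq, scaled_sub] at hne
  have hr := snScale_ne_zero hτ
  have hleg : ∀ q z, theta4 τ q ≠ 0 → leg τ q z = theta4 τ q * (z - thetaRatio τ q) := by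
    intro q z hq
    rw [leg, theta1_eq_thetaRatio_mul hq]; ring
  have hd : thetaRatio τ (scaled τ ζ) - thetaRatio τ (scaled τ ξ - scaled τ γ) ≠ 0 :=
    fun h => hne (by rw [sub_eq_zero.1 h])
  rw [hleg _ _ hp, hleg _ _ hm]
  refine ⟨mul_ne_zero hm hd, ?_⟩
  rw [legF, sn_eq, sn_eq, sn_eq, scaled_add, scaled_sub, ← mul_sub, ← mul_sub,
    mul_div_mul_left _ _ hr, div_mul_div_comm, mul_comm (theta4 τ _), mul_comm (theta4 τ _)]
  change _ * theta4 τ (scaled τ (ξ + γ)) / (_ * theta4 τ (scaled τ (ξ - γ))) = _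
  rw [scaled_add, scaled_sub]

lemma todaRelation_iff (hτ : 0 < τ.im) {α β : ℤ → ℂ} {ξ : ℤ → ℤ → ℂ} {n m : ℤ}
    (h : TodaRelationDefined τ α β ξ n m) :
    TodaRelation τ α β ξ n m ↔
      leg τ (scaled τ (ξ n m) + scaled τ (α (n + 1) - β (m + 1)))
          (thetaRatio τ (scaled τ (ξ (n + 1) (m + 1))))
        * leg τ (scaled τ (ξ n m) + scaled τ (α n - β m))
          (thetaRatio τ (scaled τ (ξ (n - 1) (m - 1))))
        * leg τ (scaled τ (ξ n m) - scaled τ (α n - β (m + 1)))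
          (thetaRatio τ (scaled τ (ξ (n - 1) (m + 1))))
        * leg τ (scaled τ (ξ n m) - scaled τ (α (n + 1) - β m))
          (thetaRatio τ (scaled τ (ξ (n + 1) (m - 1))))
      = leg τ (scaled τ (ξ n m) - scaled τ (α (n + 1) - β (m + 1)))
          (thetaRatio τ (scaled τ (ξ (n + 1) (m + 1))))
        * leg τ (scaled τ (ξ n m) - scaled τ (α n - β m))
          (thetaRatio τ (scaled τ (ξ (n - 1) (m - 1))))
        * leg τ (scaled τ (ξ n m) + scaled τ (α n - β (m + 1)))
          (thetaRatio τ (scaled τ (ξ (n - 1) (m + 1))))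
        * leg τ (scaled τ (ξ n m) + scaled τ (α (n + 1) - β m))
          (thetaRatio τ (scaled τ (ξ (n + 1) (m - 1)))) := by
  obtain ⟨h₁, h₂, h₃, h₄⟩ := h
  obtain ⟨n₁, e₁⟩ := legF_eq hτ h₁
  obtain ⟨n₂, e₂⟩ := legF_eq hτ h₂
  obtain ⟨n₃, e₃⟩ := legF_eq hτ h₃
  obtain ⟨n₄, e₄⟩ := legF_eq hτ h₄
  rw [TodaRelation, e₁, e₂, e₃, e₄, div_mul_div_comm, div_mul_div_comm,
    div_eq_div_iff (mul_ne_zero n₁ n₂) (mul_ne_zero n₃ n₄)]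
  constructor <;> intro h <;> linear_combination h

lemma CoefficientsDefined.coeffFinite {γ a b : ℂ} (h : CoefficientsDefined τ γ a b) :
    CoeffFinite τ (scaled τ γ) (scaled τ a) (scaled τ b) := by
  obtain ⟨h₁, h₂, h₃, ⟨h₄, -⟩, ⟨h₅, -⟩, ⟨h₆, -⟩, ⟨h₇, -⟩⟩ := h
  simp only [snFinite_iff, scaled_two_mul, scaled_add, scaled_sub] at h₁ h₂ h₃ h₄ h₅ h₆ h₇
  exact ⟨h₁, h₂, h₃, h₆, h₅, h₇, h₄⟩

lemma ellipticRelation_iff (hτ : 0 < τ.im) {ε : ℂ} (hε : ε ^ 2 = 1) {γ a b : ℂ}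
    (h : CoefficientsDefined τ γ a b) (um u up : ℂ) :
    EllipticRelation τ γ a b um u up ↔
      ellRel τ (scaled τ γ) (scaled τ a) (scaled τ b) (ε * um) (ε * u) (ε * up) = 0 := by
  obtain ⟨-, -, -, ⟨-, h₄⟩, ⟨-, h₂⟩, ⟨-, h₁⟩, ⟨-, h₃⟩⟩ := h
  have hr := snScale_ne_zero hτ
  have hk := modulus_mul_snScale_sq hτ
  have hε0 : ε ≠ 0 := by rintro rfl; simp at hε
  rw [EllipticRelation]
  have w₁ : omega τ γ a b / sn τ (γ + a - b)
      = modulus τ * sn τ (γ + a + b) * sn τ (γ - a + b) * sn τ (γ - a - b) := by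
    rw [omega]; field_simp
  have w₂ : omega τ γ a b / sn τ (γ - a + b)
      = modulus τ * sn τ (γ + a + b) * sn τ (γ + a - b) * sn τ (γ - a - b) := by
    rw [omega]; field_simp
  have w₃ : omega τ γ a b / sn τ (γ - a - b)
      = modulus τ * sn τ (γ + a + b) * sn τ (γ - a + b) * sn τ (γ + a - b) := by
    rw [omega]; field_simp
  have w₄ : omega τ γ a b / sn τ (γ + a + b)
      = modulus τ * sn τ (γ - a + b) * sn τ (γ + a - b) * sn τ (γ - a - b) := by
    rw [omega]; field_simp
  rw [w₁, w₂, w₃, w₄, omega]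
  simp only [sn_eq, scaled_add, scaled_sub, scaled_two_mul]
  unfold ellRel
  generalize thetaRatio τ (scaled τ γ + scaled τ a - scaled τ b) = f₁
  generalize thetaRatio τ (scaled τ γ - scaled τ a + scaled τ b) = f₂
  generalize thetaRatio τ (scaled τ γ - scaled τ a - scaled τ b) = f₃
  generalize thetaRatio τ (scaled τ γ + scaled τ a + scaled τ b) = f₄
  generalize thetaRatio τ (2 * scaled τ γ) = g
  generalize thetaRatio τ (2 * scaled τ a) = A
  generalize thetaRatio τ (2 * scaled τ b) = B
  rw [show modulus τ = (snScale τ ^ 2)⁻¹ from eq_inv_of_mul_eq_one_left hk]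
  -- Every monomial of the equation has odd degree in `m`, `u`, `p`, so the choice of the root of
  -- `k` only changes the overall sign.
  have hodd : ∀ m v p, ellPoly f₁ f₂ f₃ f₄ g A B (ε * m) (ε * v) (ε * p)
      = ε * ellPoly f₁ f₂ f₃ f₄ g A B m v p := fun m v p => by
    rcases sq_eq_one_iff.1 hε with rfl | rfl <;> unfold ellPoly <;> ring
  rw [hodd, mul_eq_zero, or_iff_right hε0]
  generalize snScale τ = r at hr
  refine Iff.trans ?_ (mul_eq_zero.trans (or_iff_right hr))
  refine Eq.congr ?_ rfl
  unfold ellPoly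
  field_simp

/-- By the square relations a zero of `θ₂` means `u² = k` and a zero of `θ₃` means `k u² = 1`: these
are the excluded branch values. -/
lemma thetaDup_ne_zero (hτ : 0 < τ.im) {ξ : ℂ} (hξ : theta4 τ ξ ≠ 0)
    (h₁ : thetaRatio τ ξ ^ 2 ≠ modulus τ) (h₂ : modulus τ * thetaRatio τ ξ ^ 2 ≠ 1) :
    thetaDup τ ξ ≠ 0 := by
  have n2 := theta2_zero_ne_zero hτ
  have n3 := theta3_zero_ne_zero hτ
  have hθ2 : theta2 τ ξ ≠ 0 := fun h => h₁ (by
    have := theta2_sq_mul hτ ξ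
    rw [h] at this
    rw [thetaRatio, modulus, div_pow, div_eq_div_iff (by positivity) (by positivity)]
    linear_combination this)
  have hθ3 : theta3 τ ξ ≠ 0 := fun h => h₂ (by
    have := theta3_sq_mul hτ ξ
    rw [h] at this
    rw [thetaRatio, modulus, div_pow, div_mul_div_comm, div_eq_one_iff_eq (by positivity)]
    linear_combination this)
  exact div_ne_zero (by simp [hθ2, hθ3, hξ]) (theta_zero_ne_zero hτ)

end Translation

/-! ### The statements on the lattice. -/

section Lattice

variable {τ : ℂ}

/-- Symmetries of the square that fix the parameters; with them all four quads around a vertex are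
based at that vertex. -/
lemma quad_comm (A B C w x y z : ℂ) : quad A B C z y x w = quad A B C w x y z := by
  unfold quad quadLead quadConst; ring

lemma quad_comm' (A B C w x y z : ℂ) : quad A B C x w z y = quad A B C w x y z := by
  unfold quad quadLead quadConst; ring

/-- The quad equations on the four quads around a vertex, solved from that vertex. -/
lemma IsQ4Solution.quads (hτ : 0 < τ.im) {ε : ℂ} (hε : ε ^ 2 = 1) {α β : ℤ → ℂ} {v : ℤ → ℤ → ℂ}
    (hv : IsQ4Solution τ α β v) (n m : ℤ) :
    quad (thetaRatio τ (scaled τ (α (n + 1)))) (thetaRatio τ (scaled τ (β (m + 1))))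
      (thetaRatio τ (scaled τ (α (n + 1)) - scaled τ (β (m + 1))))
      (ε * v n m) (ε * v (n + 1) m) (ε * v n (m + 1)) (ε * v (n + 1) (m + 1)) = 0 ∧
    quad (thetaRatio τ (scaled τ (α n))) (thetaRatio τ (scaled τ (β m)))
      (thetaRatio τ (scaled τ (α n) - scaled τ (β m)))
      (ε * v n m) (ε * v (n - 1) m) (ε * v n (m - 1)) (ε * v (n - 1) (m - 1)) = 0 ∧
    quad (thetaRatio τ (scaled τ (α n))) (thetaRatio τ (scaled τ (β (m + 1))))
      (thetaRatio τ (scaled τ (α n) - scaled τ (β (m + 1))))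
      (ε * v n m) (ε * v (n - 1) m) (ε * v n (m + 1)) (ε * v (n - 1) (m + 1)) = 0 ∧
    quad (thetaRatio τ (scaled τ (α (n + 1)))) (thetaRatio τ (scaled τ (β m)))
      (thetaRatio τ (scaled τ (α (n + 1)) - scaled τ (β m)))
      (ε * v n m) (ε * v (n + 1) m) (ε * v n (m - 1)) (ε * v (n + 1) (m - 1)) = 0 := by
  refine ⟨(Q4_eq_zero_iff hτ hε _ _ _ _ _ _).1 (hv n m), ?_, ?_, ?_⟩
  · rw [quad_comm, ← Q4_eq_zero_iff hτ hε]
    simpa using hv (n - 1) (m - 1)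
  · rw [quad_comm', ← Q4_eq_zero_iff hτ hε]
    simpa using hv (n - 1) m
  · rw [← quad_comm, quad_comm', ← Q4_eq_zero_iff hτ hε]
    simpa using hv n (m - 1)

lemma DiagonallyDetermined.quadLead_ne_zero (hτ : 0 < τ.im) {ε : ℂ} (hε : ε ^ 2 = 1)
    {α β : ℤ → ℂ} {v : ℤ → ℤ → ℂ} {n m : ℤ} (h : DiagonallyDetermined τ α β v n m) :
    quadLead (thetaRatio τ (scaled τ (α (n + 1)))) (thetaRatio τ (scaled τ (β (m + 1))))
      (thetaRatio τ (scaled τ (α (n + 1)) - scaled τ (β (m + 1))))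
      (ε * v n m) (ε * v (n + 1) m) (ε * v n (m + 1)) ≠ 0 ∧
    quadLead (thetaRatio τ (scaled τ (α n))) (thetaRatio τ (scaled τ (β m)))
      (thetaRatio τ (scaled τ (α n) - scaled τ (β m)))
      (ε * v n m) (ε * v (n - 1) m) (ε * v n (m - 1)) ≠ 0 := by
  obtain ⟨h₁, h₂⟩ := h
  simp only [Q4_eq_zero_iff hτ hε] at h₁ h₂
  simp only [← quad_comm _ _ _ _ _ _ (ε * v n m)] at h₂
  exact ⟨quadLead_ne_zero_of_existsUnique h₁, quadLead_ne_zero_of_existsUnique h₂⟩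

theorem todaRelation_of_isQ4Solution (hτ : 0 < τ.im) {s : ℂ} (hε : (s * snScale τ) ^ 2 = 1)
    {α β : ℤ → ℂ} (hP : ParametersFinite τ α β) {v : ℤ → ℤ → ℂ} (hv : IsQ4Solution τ α β v)
    {ξ : ℤ → ℤ → ℂ} (hξ : IsUniformisation τ s v ξ) {n m : ℤ}
    (hd : DiagonallyDetermined τ α β v n m) (hT : TodaRelationDefined τ α β ξ n m) :
    TodaRelation τ α β ξ n m := by
  rw [todaRelation_iff hτ hT]
  obtain ⟨hα, hβ, hαβ⟩ := hP
  simp only [snFinite_iff, scaled_sub] at hα hβ hαβ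
  have hu : ∀ i j, s * snScale τ * v i j = thetaRatio τ (scaled τ (ξ i j)) := fun i j => by
    rw [(hξ i j).2, sn_eq]
    linear_combination (thetaRatio τ (scaled τ (ξ i j))) * hε
  have h0 : theta4 τ (scaled τ (ξ n m)) ≠ 0 := (hξ n m).1
  simp only [scaled_sub]
  by_cases hH : thetaDup τ (scaled τ (ξ n m)) = 0
  · obtain ⟨⟨-, -, h₁, -⟩, ⟨-, -, h₂, -⟩, ⟨-, -, h₃, -⟩, ⟨-, -, h₄, -⟩⟩ := hT
    simp only [snFinite_iff, scaled_sub] at h₁ h₂ h₃ h₄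
    exact toda_of_thetaDup_eq_zero hτ hH h0 h₁ h₂ h₃ h₄ _ _ _ _
  · obtain ⟨q₁, q₂, q₃, q₄⟩ := hv.quads hτ hε n m
    obtain ⟨l₁, l₂⟩ := hd.quadLead_ne_zero hτ hε
    simp only [hu] at q₁ q₂ q₃ q₄ l₁ l₂
    exact toda_of_quad hτ (hα _) (hα _) (hβ _) (hβ _) (hαβ _ _) (hαβ _ _) (hαβ _ _) (hαβ _ _)
      h0 hH l₁ l₂ q₁ q₂ q₃ q₄

/-- The differences of linear lattice parameters around the vertex `(n, n)`. -/
lemma linear_parameters {α β : ℤ → ℂ} (hα : ∀ n : ℤ, α n = α 0 + n * (α 1 - α 0))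
    (hβ : ∀ m : ℤ, β m = β 0 + m * (β 1 - β 0)) {a b γ₀ : ℂ} (ha : a = (α 1 - α 0) / 2)
    (hb : b = (β 1 - β 0) / 2) (hγ : γ₀ = (α 0 + α 1 - β 0 - β 1) / 2) (n : ℤ) :
    α (n + 1) - β (n + 1) = gam γ₀ a b n + a - b ∧ α n - β n = gam γ₀ a b n - a + b ∧
    α n - β (n + 1) = gam γ₀ a b n - a - b ∧ α (n + 1) - β n = gam γ₀ a b n + a + b := by
  rw [hα (n + 1), hα n, hβ (n + 1), hβ n, gam, ha, hb, hγ]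
  push_cast
  refine ⟨?_, ?_, ?_, ?_⟩ <;> ring

theorem todaRelation_iff_ellipticEquation (hτ : 0 < τ.im) {s : ℂ}
    (hε : (s * snScale τ) ^ 2 = 1) {α β : ℤ → ℂ} {a b γ₀ : ℂ} {n : ℤ}
    (hpar : α (n + 1) - β (n + 1) = gam γ₀ a b n + a - b ∧ α n - β n = gam γ₀ a b n - a + b ∧
      α n - β (n + 1) = gam γ₀ a b n - a - b ∧ α (n + 1) - β n = gam γ₀ a b n + a + b)
    {v ξ : ℤ → ℤ → ℂ} (hξ : IsUniformisation τ s v ξ) (hc : DiagonalConstraint v)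
    (hC : CoefficientsDefined τ (gam γ₀ a b n) a b) (hT : TodaRelationDefined τ α β ξ n n)
    (h₁ : v n n ^ 2 ≠ modulus τ) (h₂ : modulus τ * v n n ^ 2 ≠ 1) :
    TodaRelation τ α β ξ n n ↔ EllipticEquation τ γ₀ a b (fun j => v j j) n := by
  rw [todaRelation_iff hτ hT, EllipticEquation, ellipticRelation_iff hτ hε hC]
  have hC' := hC.coeffFinite
  obtain ⟨e₁, e₂, e₃, e₄⟩ := hpar
  obtain ⟨c₁, c₂⟩ := hc n
  have hu : ∀ i j, thetaRatio τ (scaled τ (ξ i j)) = s * snScale τ * v i j := fun i j => by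
    rw [(hξ i j).2, sn_eq]
    linear_combination (-thetaRatio τ (scaled τ (ξ i j))) * hε
  have h0 : theta4 τ (scaled τ (ξ n n)) ≠ 0 := (hξ n n).1
  have hsq : thetaRatio τ (scaled τ (ξ n n)) ^ 2 = v n n ^ 2 := by
    rw [hu]; linear_combination v n n ^ 2 * hε
  -- Needed only to pass from the Toda-type relation to the elliptic equation; the converse uses
  -- `θ₄(0) ≠ 0`.
  have hH := thetaDup_ne_zero hτ h0 (by rwa [hsq]) (by rwa [hsq])
  rw [e₁, e₂, e₃, e₄, hu (n - 1) (n + 1), hu (n + 1) (n - 1), c₁, ← c₂, ← hu n n, ← hu (n - 1),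
    ← hu (n + 1)]
  simp only [scaled_add, scaled_sub]
  have key := toda_eq_ellRel hτ h0 hC' (thetaRatio τ (scaled τ (ξ (n - 1) (n - 1))))
    (thetaRatio τ (scaled τ (ξ (n + 1) (n + 1))))
  obtain ⟨-, -, -, k₁, k₂, k₃, k₄⟩ := hC'
  have n4 := theta4_zero_ne_zero hτ
  rw [← sub_eq_zero]
  constructor
  · intro h
    rw [h] at key
    simpa [hH, h0, k₁, k₂, k₃, k₄] using key
  · intro h
    rw [h] at key
    simpa [n4] using key

theorem ellipticEquation_of_isQ4Solution (hτ : 0 < τ.im) {s : ℂ} (hε : (s * snScale τ) ^ 2 = 1)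
    {α β : ℤ → ℂ} {a b γ₀ : ℂ} {n : ℤ}
    (hpar : α (n + 1) - β (n + 1) = gam γ₀ a b n + a - b ∧ α n - β n = gam γ₀ a b n - a + b ∧
      α n - β (n + 1) = gam γ₀ a b n - a - b ∧ α (n + 1) - β n = gam γ₀ a b n + a + b)
    (hP : ParametersFinite τ α β) {v : ℤ → ℤ → ℂ} (hv : IsQ4Solution τ α β v)
    (hc : DiagonalConstraint v) (hd : DiagonallyDetermined τ α β v n n)
    (hC : CoefficientsDefined τ (gam γ₀ a b n) a b) :
    EllipticEquation τ γ₀ a b (fun j => v j j) n := by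
  rw [EllipticEquation, ellipticRelation_iff hτ hε hC]
  obtain ⟨hα, hβ, -⟩ := hP
  simp only [snFinite_iff] at hα hβ
  obtain ⟨q₁, q₂, q₃, q₄⟩ := hv.quads hτ hε n n
  obtain ⟨l₁, l₂⟩ := hd.quadLead_ne_zero hτ hε
  obtain ⟨e₁, e₂, e₃, e₄⟩ := hpar
  obtain ⟨c₁, c₂⟩ := hc n
  rw [c₁] at q₃
  rw [← c₂] at q₄
  -- Only the central value has to be uniformised; the others enter polynomially.
  obtain ⟨ξ, hξ, hξv⟩ := exists_thetaRatio_eq hτ (s * snScale τ * v n n)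
  apply_fun scaled τ at e₁ e₂ e₃ e₄
  simp only [scaled_add, scaled_sub] at e₁ e₂ e₃ e₄
  rw [e₁] at q₁ l₁
  rw [e₂] at q₂ l₂
  rw [e₃] at q₃
  rw [e₄] at q₄
  rw [← hξv] at q₁ q₂ q₃ q₄ l₁ l₂ ⊢
  exact ellRel_of_quad hτ e₁ e₂ e₃ e₄ hC.coeffFinite (hα _) (hα _) (hβ _) (hβ _) hξ l₁ l₂ q₁ q₂
    q₃ q₄

theorem ellipticEquation_sn (hτ : 0 < τ.im) {s : ℂ} (hε : (s * snScale τ) ^ 2 = 1)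
    {γ₀ a b ξ₀ : ℂ} {n : ℤ} (hC : CoefficientsDefined τ (gam γ₀ a b n) a b)
    (hξ : ∀ j : ℤ, n - 1 ≤ j → j ≤ n + 1 → SnFinite τ (ξ₀ + γ₀ * j + (a - b) * j ^ 2)) :
    EllipticEquation τ γ₀ a b (fun j => s * sn τ (ξ₀ + γ₀ * j + (a - b) * j ^ 2)) n := by
  rw [EllipticEquation, ellipticRelation_iff hτ hε hC]
  have h0 := hξ n (by omega) (by omega)
  have hm := hξ (n - 1) (by omega) (by omega)
  have hp := hξ (n + 1) (by omega) (by omega)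
  -- The quadratic phase has increments `γ - (a - b)` before and `γ + (a - b)` after the place `n`,
  -- which are the shifts in the legs of `m` and `p`.
  have em : ξ₀ + γ₀ * ((n - 1 : ℤ) : ℂ) + (a - b) * ((n - 1 : ℤ) : ℂ) ^ 2
      = ξ₀ + γ₀ * n + (a - b) * n ^ 2 - (gam γ₀ a b n - a + b) := by
    rw [gam]; push_cast; ring
  have ep : ξ₀ + γ₀ * ((n + 1 : ℤ) : ℂ) + (a - b) * ((n + 1 : ℤ) : ℂ) ^ 2
      = ξ₀ + γ₀ * n + (a - b) * n ^ 2 + (gam γ₀ a b n + a - b) := by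
    rw [gam]; push_cast; ring
  rw [em] at hm
  rw [ep] at hp
  have hu : ∀ z, s * snScale τ * (s * sn τ z) = thetaRatio τ (scaled τ z) := fun z => by
    rw [sn_eq]; linear_combination thetaRatio τ (scaled τ z) * hε
  simp only [hu, em, ep]
  generalize ξ₀ + γ₀ * n + (a - b) * n ^ 2 = ξ at *
  generalize gam γ₀ a b n = γ at *
  rw [snFinite_iff] at h0 hm hp
  rw [scaled_sub ξ, scaled_add _ b, scaled_sub γ a] at hm ⊢
  rw [scaled_add ξ, scaled_sub _ b, scaled_add γ a] at hp ⊢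
  exact ellRel_thetaRatio hτ hC.coeffFinite h0 hm hp

end Lattice

end EllipticQ4

end

theorem mainTheorem6 (τ : ℂ) (hτ : 0 < τ.im) (s : ℂ) (hs : s ^ 2 = modulus τ) :
    -- Q4 implies the Toda-type five-point relation, for arbitrary lattice parameters
    (∀ α β : ℤ → ℂ, ParametersFinite τ α β →
      ∀ v : ℤ → ℤ → ℂ, IsQ4Solution τ α β v →
      ∀ ξ : ℤ → ℤ → ℂ, IsUniformisation τ s v ξ →
      ∀ n m : ℤ, DiagonallyDetermined τ α β v n m → TodaRelationDefined τ α β ξ n m →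
        TodaRelation τ α β ξ n m) ∧
    -- the reduction with linear lattice parameters
    (∀ α β : ℤ → ℂ,
      (∀ n : ℤ, α n = α 0 + n * (α 1 - α 0)) → (∀ m : ℤ, β m = β 0 + m * (β 1 - β 0)) →
      ∀ a b γ₀ : ℂ, a = (α 1 - α 0) / 2 → b = (β 1 - β 0) / 2 →
        γ₀ = (α 0 + α 1 - β 0 - β 1) / 2 →
      -- under the constraint, the five-point relation is the elliptic equation
      (∀ v ξ : ℤ → ℤ → ℂ, IsUniformisation τ s v ξ → DiagonalConstraint v →
        ∀ n : ℤ, CoefficientsDefined τ (gam γ₀ a b n) a b → TodaRelationDefined τ α β ξ n n →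
          v n n ^ 2 ≠ modulus τ → modulus τ * v n n ^ 2 ≠ 1 →
          (TodaRelation τ α β ξ n n ↔ EllipticEquation τ γ₀ a b (fun j => v j j) n)) ∧
      -- hence Q4 with the constraint implies the elliptic equation
      (ParametersFinite τ α β →
        ∀ v : ℤ → ℤ → ℂ, IsQ4Solution τ α β v → DiagonalConstraint v →
        ∀ n : ℤ, DiagonallyDetermined τ α β v n n → CoefficientsDefined τ (gam γ₀ a b n) a b →
          EllipticEquation τ γ₀ a b (fun j => v j j) n)) ∧
    -- the trivial solution
    (∀ γ₀ a b ξ₀ : ℂ, ∀ n : ℤ, CoefficientsDefined τ (gam γ₀ a b n) a b →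
      (∀ j : ℤ, n - 1 ≤ j → j ≤ n + 1 → SnFinite τ (ξ₀ + γ₀ * j + (a - b) * j ^ 2)) →
      EllipticEquation τ γ₀ a b (fun j => s * sn τ (ξ₀ + γ₀ * j + (a - b) * j ^ 2)) n) := by
  -- Both `s` and `1 / snScale τ` are square roots of `k`, so they agree up to sign.
  have hε : (s * snScale τ) ^ 2 = 1 := by
    rw [mul_pow, hs, modulus_mul_snScale_sq hτ]
  refine ⟨fun α β hP v hv ξ hξ n m hd hT => todaRelation_of_isQ4Solution hτ hε hP hv hξ hd hT,
    fun α β hα hβ a b γ₀ ha hb hγ => ⟨fun v ξ hξ hc n hC hT h₁ h₂ => ?_,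
      fun hP v hv hc n hd hC => ?_⟩, fun γ₀ a b ξ₀ n hC hξ => ellipticEquation_sn hτ hε hC hξ⟩
  · exact todaRelation_iff_ellipticEquation hτ hε (linear_parameters hα hβ ha hb hγ n) hξ hc
      hC hT h₁ h₂
  · exact ellipticEquation_of_isQ4Solution hτ hε (linear_parameters hα hβ ha hb hγ n) hP hv hc
      hd hC
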